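/- Conventions. Let $A,B$ be C*-algebras (not necessarily unital). An $A$-$B$-correspondence is a right Hilbert $B$-module $X$ together with a (possibly degenerate) $*$-homomorphism $\phi_X$ from $A$ to the C*-algebra of adjointable operators on $X$; when $A=B$ it is called a correspondence over $A$. Write $X\approx Y$ if there is a unitary $A$-$B$-bimodule map from $X$ onto $Y$. The interior tensor product $X\otimes_B Y$ of an $A$-$B$-correspondence $X$ and a $B$-$C$-correspondence $Y$ is the $A$-$C$-correspondence obtained from the algebraic tensor product by separation and completion with respect to $\langle x_1\otimes y_1,x_2\otimes y_2\rangle=\langle y_1,\phi_Y(\langle x_1,x_2\rangle)y_2\rangle$, with $(x\otimes y)c = x\otimes yc$ and $a(x\otimes y)=\phi_X(a)x\otimes y$. An $A$-$B$-imprimitivity bimodule is an $A$-$B$-correspondence $M$ that is also a left Hilbert $A$-module with an $A$-valued left inner product ${}_A\langle\cdot,\cdot\rangle$ such that ${}_A\langle x,y\rangle z=x\langle y,z\rangle$ for all $x,y,z\in M$, and for which the closed linear spans of ${}_A\langle M,M\rangle$ and $\langle M,M\rangle$ are $A$ and $B$, respectively. For a correspondence $E$ over $A$ and a correspondence $F$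 over $B$ we say that $E$ and $F$ are - strong Morita equivalent if there is an $A$-$B$-imprimitivity bimodule $M$ with $E\otimes_A M\approx M\otimes_B F$; - elementary strong shift equivalent if there are an $A$-$B$-correspondence $R$ and a $B$-$A$-correspondence $S$ with $E\approx R\otimes_B S$ and $F\approx S\otimes_A R$; - strong shift equivalent if they are related by the transitive closure of elementary strong shift equivalence on the class of all correspondences over arbitrary C*-algebras; - shift equivalent if there are an $A$-$B$-correspondence $R$, a $B$-$A$-correspondence $S$ and an integer $m\ge 1$ with $E^{\otimes m}\approx R\otimes_B S$, $F^{\otimes m}\approx S\otimes_A R$, $S\otimes_A E\approx F\otimes_B S$ and $E\otimes_A R\approx R\otimes_B F$. Theorem. Let $E$ be an $A$-$A$-imprimitivity bimodule and let $F$ be a $B$-$B$-imprimitivity bimodule. Then the following are equivalent: (1) $E$ and $F$ are strong Morita equivalent; (2) $E$ and $F$ are elementary strong shift equivalent; (3) $E$ and $F$ are strong shift equivalent; (4) $E$ and $F$ are shift equivalent. -/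

import Mathlib

universe u

open scoped TensorProduct CStarAlgebra

/-! ## Positivity in a C*-algebra -/

/-- An element of a C*-algebra is positive if it is of the form `b* b`. -/
def CStarPos {B : Type u} [NonUnitalCStarAlgebra B] (a : B) : Prop := ∃ b : B, a = star b * b

namespace CStarPos

variable {B : Type u} [NonUnitalCStarAlgebra B]

theorem iff_nonneg [PartialOrder B] [StarOrderedRing B] {a : B} : CStarPos a ↔ 0 ≤ a :=
  CStarAlgebra.nonneg_iff_eq_star_mul_self.symm

theorem sum {ι : Type*} (s : Finset ι) (f : ι → B) (h : ∀ i ∈ s, CStarPos (f i)) :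
    CStarPos (∑ i ∈ s, f i) := by
  let _ := CStarAlgebra.spectralOrder B
  have := CStarAlgebra.spectralOrderedRing B
  simp only [iff_nonneg] at h ⊢
  exact Finset.sum_nonneg h

theorem isClosed : IsClosed {a : B | CStarPos a} := by
  let _ := CStarAlgebra.spectralOrder B
  have := CStarAlgebra.spectralOrderedRing B
  simp only [iff_nonneg]
  exact CStarAlgebra.isClosed_nonneg

theorem norm_le {a b : B} (ha : CStarPos a) (hab : CStarPos (b - a)) : ‖a‖ ≤ ‖b‖ := by
  let _ := CStarAlgebra.spectralOrder B
  have := CStarAlgebra.spectralOrderedRing B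
  rw [iff_nonneg] at ha hab
  exact CStarAlgebra.norm_le_norm_of_nonneg_of_le ha (sub_nonneg.1 hab)

theorem exists_parts {M : B} (hM : IsSelfAdjoint M) :
    ∃ P N S T : B, M = P - N ∧ N * P = 0 ∧ N = S * S ∧ star N = N ∧ star S = S ∧
      P = star T * T := by
  let _ := CStarAlgebra.spectralOrder B
  have := CStarAlgebra.spectralOrderedRing B
  obtain ⟨T, hT⟩ := CStarAlgebra.nonneg_iff_eq_star_mul_self.1 (CFC.posPart_nonneg M)
  exact ⟨M⁺, M⁻, CFC.sqrt (M⁻), T, (CFC.posPart_sub_negPart M hM).symm,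
    CFC.negPart_mul_posPart M, CStarAlgebra.nonneg_iff_eq_sqrt_mul_sqrt.1 (CFC.negPart_nonneg M),
    (IsSelfAdjoint.of_nonneg (CFC.negPart_nonneg M)).star_eq,
    (IsSelfAdjoint.of_nonneg (CFC.sqrt_nonneg (M⁻))).star_eq, hT⟩

/-- A self-adjoint matrix `G` over a C*-algebra all of whose conjugates `Σ bᵢ* Gᵢⱼ bⱼ` are positive
is of the form `T* T`. -/
theorem matrix {ι : Type*} [Fintype ι] (G : ι → ι → B)
    (hG : ∀ i j, star (G i j) = G j i)
    (hpos : ∀ b : ι → B, CStarPos (∑ i, ∑ j, star (b i) * G i j * b j)) :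
    ∃ T : ι → ι → B, ∀ i j, G i j = ∑ k, star (T k i) * T k j := by
  let _ := CStarAlgebra.spectralOrder B
  have := CStarAlgebra.spectralOrderedRing B
  let M : CStarMatrix ι ι B := CStarMatrix.ofMatrix (Matrix.of G)
  have hM : IsSelfAdjoint M := by
    ext i j
    exact hG j i
  obtain ⟨P, N, S, T, h1, h2, hN, hNs, hSs, hT⟩ := exists_parts hM
  have hNMN : N * M * N = -(star (S * N) * (S * N)) := by
    have h3 : N * M = -(N * N) := by
      conv_lhs => rw [h1]
      rw [mul_sub, h2, zero_sub]
    have h4 : star (S * N) * (S * N) = N * N * N := by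
      rw [star_mul, hNs, hSs]
      calc N * S * (S * N) = N * (S * S) * N := by simp only [mul_assoc]
        _ = N * N * N := by rw [← hN]
    rw [h3, h4, neg_mul]
  have hdiag : ∀ k j, (S * N) j k = 0 := by
    intro k
    have h1 : CStarPos ((N * M * N) k k) := by
      have := hpos (fun i => N i k)
      convert this using 1
      have hs : ∀ i, star (N i k) = N k i := fun i => by
        conv_rhs => rw [← hNs]
        rfl
      simp only [CStarMatrix.mul_apply, hs, Finset.sum_mul]
      rw [Finset.sum_comm]
      rfl
    have h2 : (N * M * N) k k = -∑ j, star ((S * N) j k) * (S * N) j k := by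
      rw [hNMN]
      change -((star (S * N) * (S * N)) k k) = _
      rw [CStarMatrix.mul_apply]
      rfl
    rw [iff_nonneg, h2, neg_nonneg] at h1
    have h3 : ∀ j ∈ Finset.univ, 0 ≤ star ((S * N) j k) * (S * N) j k :=
      fun j _ => star_mul_self_nonneg _
    have h4 := (Finset.sum_eq_zero_iff_of_nonneg h3).1 (le_antisymm h1 (Finset.sum_nonneg h3))
    intro j
    exact CStarRing.star_mul_self_eq_zero_iff _ |>.1 (h4 j (Finset.mem_univ _))
  have hSN : S * N = 0 := by
    ext j k
    exact hdiag k j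
  have hNN : N * N = 0 := by
    conv_lhs => rw [hN]
    rw [mul_assoc]
    have : S * (S * S) = S * N := by rw [← hN]
    simp only [hSN, mul_zero, this]
  have hN0 : N = 0 := by
    rw [← CStarRing.star_mul_self_eq_zero_iff, hNs, hNN]
  refine ⟨T, fun i j => ?_⟩
  change M i j = _
  rw [h1, hN0, sub_zero, hT, CStarMatrix.mul_apply]
  rfl

end CStarPos

/-! ## Correspondences -/

/-- An `A`-`B`-correspondence without norm and completeness: a complex vector space with a right
action of `B`, a possibly degenerate positive `B`-valued sesquilinear form, conjugate linear in the
first variable, and a left action of `A`. It serves to construct completions. -/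
structure PreCorrespondence (A B : Type u) [NonUnitalCStarAlgebra A] [NonUnitalCStarAlgebra B] where
  carrier : Type u
  [addCommGroup : AddCommGroup carrier]
  [module : Module ℂ carrier]
  rmul : carrier →ₗ[ℂ] B →ₗ[ℂ] carrier
  inner : carrier →ₗ⋆[ℂ] carrier →ₗ[ℂ] B
  φ : A →ₙₐ[ℂ] Module.End ℂ carrier
  rmul_mul : ∀ x b c, rmul x (b * c) = rmul (rmul x b) c
  inner_rmul : ∀ x y b, inner x (rmul y b) = inner x y * b
  star_inner : ∀ x y, star (inner x y) = inner y x
  inner_self_pos : ∀ x, CStarPos (inner x x)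
  inner_φ : ∀ a x y, inner (φ a x) y = inner x (φ (star a) y)

/-- An `A`-`B`-correspondence (C*-correspondence): a right Hilbert `B`-module together with a
`*`-homomorphism `φ` from `A` to the C*-algebra of its adjointable operators.

Here `rmul x b` is `x · b`, `inner x y` is the `B`-valued inner product (conjugate linear in `x`,
linear in `y`), the module is complete for the norm `‖⟨x, x⟩‖ ^ (1/2)`, and `inner_φ` says that
`φ a` is adjointable with adjoint `φ (star a)`. -/
structure CStarCorrespondence (A B : Type u) [NonUnitalCStarAlgebra A] [NonUnitalCStarAlgebra B]
    where
  carrier : Type u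
  [normedAddCommGroup : NormedAddCommGroup carrier]
  [normedSpace : NormedSpace ℂ carrier]
  [completeSpace : CompleteSpace carrier]
  rmul : carrier →ₗ[ℂ] B →ₗ[ℂ] carrier
  inner : carrier →ₗ⋆[ℂ] carrier →ₗ[ℂ] B
  φ : A →ₙₐ[ℂ] Module.End ℂ carrier
  rmul_mul : ∀ x b c, rmul x (b * c) = rmul (rmul x b) c
  inner_rmul : ∀ x y b, inner x (rmul y b) = inner x y * b
  star_inner : ∀ x y, star (inner x y) = inner y x
  inner_self_pos : ∀ x, CStarPos (inner x x)
  norm_sq : ∀ x, ‖x‖ ^ 2 = ‖inner x x‖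
  inner_φ : ∀ a x y, inner (φ a x) y = inner x (φ (star a) y)

namespace PreCorrespondence

variable {A B : Type u} [NonUnitalCStarAlgebra A] [NonUnitalCStarAlgebra B]

instance : CoeSort (PreCorrespondence A B) (Type u) := ⟨carrier⟩

variable (P : PreCorrespondence A B)

instance : AddCommGroup P := P.addCommGroup
instance : Module ℂ P := P.module

theorem inner_rmul_left (x y : P) (b : B) :
    P.inner (P.rmul x b) y = star b * P.inner x y := by
  rw [← P.star_inner, P.inner_rmul, star_mul, P.star_inner]

/-- The Cauchy-Schwarz inequality. -/
theorem norm_inner_sq_le (x y : P) :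
    ‖P.inner x y‖ ^ 2 ≤ ‖P.inner x x‖ * ‖P.inner y y‖ := by
  let _ := CStarAlgebra.spectralOrder B
  have := CStarAlgebra.spectralOrderedRing B
  have key : ∀ K : ℝ, 0 < K → ‖P.inner x x‖ ≤ K → ‖P.inner x y‖ ^ 2 ≤ K * ‖P.inner y y‖ := by
    intro K hK hxK
    set a := P.inner x y with ha
    have ha' : P.inner y x = star a := by rw [ha, P.star_inner]
    have h0 : 0 ≤ P.inner (P.rmul x a - (K : ℂ) • y) (P.rmul x a - (K : ℂ) • y) :=
      CStarPos.iff_nonneg.1 (P.inner_self_pos _)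
    have h1 : P.inner (P.rmul x a - (K : ℂ) • y) (P.rmul x a - (K : ℂ) • y)
        = star a * P.inner x x * a - K • (star a * a) - K • (star a * a)
          + K • (K • P.inner y y) := by
      simp only [map_sub, LinearMap.sub_apply, P.inner_rmul, P.inner_rmul_left, map_smul,
        LinearMap.map_smulₛₗ, LinearMap.smul_apply, Complex.conj_ofReal, ha', ← ha]
      simp only [mul_assoc, Complex.coe_smul, smul_sub]
      abel
    have h2 : star a * P.inner x x * a ≤ K • (star a * a) := by
      refine (CStarAlgebra.star_left_conjugate_le_norm_smul (a := a) (b := P.inner x x)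
        (hb := CStarPos.iff_nonneg.1 (P.inner_self_pos x) |>.isSelfAdjoint)).trans ?_
      exact smul_le_smul_of_nonneg_right hxK (star_mul_self_nonneg a)
    have h3 : K • (star a * a) ≤ K • (K • P.inner y y) := by
      rw [h1] at h0
      have h5 : K • (star a * a) ≤ star a * P.inner x x * a - K • (star a * a)
          + K • (K • P.inner y y) := by
        rw [← sub_nonneg]
        convert h0 using 1
        abel
      refine h5.trans ?_
      have : star a * P.inner x x * a - K • (star a * a) ≤ 0 := sub_nonpos.2 h2
      simpa using add_le_add_left this (K • (K • P.inner y y))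
    have h4 : star a * a ≤ K • P.inner y y := (smul_le_smul_iff_of_pos_left hK).1 h3
    have h5 := CStarAlgebra.norm_le_norm_of_nonneg_of_le (star_mul_self_nonneg a) h4
    rw [CStarRing.norm_star_mul_self, norm_smul, Real.norm_of_nonneg hK.le, ← pow_two] at h5
    exact h5
  have h : ∀ ε : ℝ, 0 < ε → ‖P.inner x y‖ ^ 2 ≤ (‖P.inner x x‖ + ε) * ‖P.inner y y‖ :=
    fun ε hε => key _ (by positivity) (by linarith)
  have hlim : Filter.Tendsto (fun ε : ℝ => (‖P.inner x x‖ + ε) * ‖P.inner y y‖)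
      (nhdsWithin 0 (Set.Ioi 0)) (nhds ((‖P.inner x x‖ + 0) * ‖P.inner y y‖)) := by
    apply Filter.Tendsto.mono_left _ nhdsWithin_le_nhds
    exact Continuous.tendsto (by fun_prop) 0
  rw [add_zero] at hlim
  exact ge_of_tendsto hlim (Filter.eventually_of_mem self_mem_nhdsWithin h)

noncomputable instance : Norm P := ⟨fun x => √‖P.inner x x‖⟩

theorem norm_sq (x : P) : ‖x‖ ^ 2 = ‖P.inner x x‖ := Real.sq_sqrt (norm_nonneg _)

theorem norm_inner_le (x y : P) : ‖P.inner x y‖ ≤ ‖x‖ * ‖y‖ := by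
  have h := P.norm_inner_sq_le x y
  rw [← P.norm_sq, ← P.norm_sq, ← mul_pow] at h
  exact le_of_sq_le_sq h (mul_nonneg (Real.sqrt_nonneg _) (Real.sqrt_nonneg _))

theorem seminormedSpaceCore : SeminormedSpace.Core ℂ P where
  norm_nonneg x := Real.sqrt_nonneg _
  norm_smul c x := by
    refine (sq_eq_sq₀ (Real.sqrt_nonneg _) (mul_nonneg (norm_nonneg _) (Real.sqrt_nonneg _))).1 ?_
    change ‖c • x‖ ^ 2 = (‖c‖ * ‖x‖) ^ 2
    rw [mul_pow, norm_sq, norm_sq]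
    simp only [map_smul, LinearMap.map_smulₛₗ, LinearMap.smul_apply, norm_smul, RCLike.norm_conj]
    ring
  norm_triangle x y := by
    have hx : 0 ≤ ‖x‖ := Real.sqrt_nonneg _
    have hy : 0 ≤ ‖y‖ := Real.sqrt_nonneg _
    refine le_of_sq_le_sq ?_ (add_nonneg hx hy)
    rw [norm_sq]
    simp only [map_add, LinearMap.add_apply]
    have h1 := P.norm_inner_le x y
    have h2 := P.norm_inner_le y x
    have h3 := P.norm_sq x
    have h4 := P.norm_sq y
    have h5 := norm_add₄_le (a := P.inner x x) (b := P.inner y x) (c := P.inner x y)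
      (d := P.inner y y)
    rw [← add_assoc]
    nlinarith

noncomputable instance : SeminormedAddCommGroup P := .ofCore P.seminormedSpaceCore

noncomputable instance : NormedSpace ℂ P where
  norm_smul_le c x := (P.seminormedSpaceCore.norm_smul c x).le

theorem norm_rmul_le (x : P) (b : B) : ‖P.rmul x b‖ ≤ ‖x‖ * ‖b‖ := by
  refine le_of_sq_le_sq ?_ (by positivity)
  rw [norm_sq, P.inner_rmul, P.inner_rmul_left, mul_pow, P.norm_sq x]
  calc ‖star b * P.inner x x * b‖ ≤ ‖star b‖ * ‖P.inner x x‖ * ‖b‖ := norm_mul₃_le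
    _ = ‖P.inner x x‖ * ‖b‖ ^ 2 := by rw [norm_star]; ring

theorem norm_φ_le (a : A) (x : P) : ‖P.φ a x‖ ≤ ‖a‖ * ‖x‖ := by
  refine le_of_sq_le_sq ?_ (by positivity)
  obtain ⟨r, hr⟩ : ∃ r : Unitization ℂ A,
      algebraMap ℝ (Unitization ℂ A) (‖a‖ ^ 2) - star (a : Unitization ℂ A) * a = star r * r := by
    refine CStarAlgebra.nonneg_iff_eq_star_mul_self.1 (sub_nonneg.2 ?_)
    have := CStarAlgebra.star_mul_le_algebraMap_norm_sq (a := (a : Unitization ℂ A))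
    rwa [Unitization.norm_inr] at this
  have h1 : ((‖a‖ ^ 2 : ℝ) : ℂ) = starRingEnd ℂ r.fst * r.fst := by
    have := congrArg (fun z : Unitization ℂ A => z.fst) hr
    rw [IsScalarTower.algebraMap_apply ℝ ℂ (Unitization ℂ A), Unitization.algebraMap_eq_inl] at this
    change ((‖a‖ ^ 2 : ℝ) : ℂ) - (star (a : Unitization ℂ A) * (a : Unitization ℂ A)).fst = _ at this
    simpa using this
  have h2 : -(star a * a) = starRingEnd ℂ r.fst • r.snd + r.fst • star r.snd + star r.snd * r.snd := by
    have := congrArg (fun z : Unitization ℂ A => z.snd) hr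
    rw [IsScalarTower.algebraMap_apply ℝ ℂ (Unitization ℂ A), Unitization.algebraMap_eq_inl] at this
    change (0 : A) - (star (a : Unitization ℂ A) * (a : Unitization ℂ A)).snd = _ at this
    simpa using this
  have h3 : P.inner (r.fst • x + P.φ r.snd x) (r.fst • x + P.φ r.snd x)
      = ((‖a‖ ^ 2 : ℝ) : ℂ) • P.inner x x - P.inner (P.φ a x) (P.φ a x) := by
    have e1 : P.inner (P.φ a x) (P.φ a x) = P.inner x (P.φ (star a * a) x) := by
      rw [P.inner_φ, map_mul]; rfl
    have e2 : P.inner (P.φ r.snd x) (P.φ r.snd x) = P.inner x (P.φ (star r.snd * r.snd) x) := by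
      rw [P.inner_φ, map_mul]; rfl
    rw [e1, h1, sub_eq_add_neg, ← map_neg, ← LinearMap.neg_apply, ← map_neg, h2]
    simp only [map_add, LinearMap.add_apply, map_smul, LinearMap.map_smulₛₗ,
      LinearMap.smul_apply, e2, P.inner_φ, mul_smul]
    simp only [smul_smul, smul_add, mul_comm (starRingEnd ℂ _)]
    abel
  have h4 := CStarPos.norm_le (P.inner_self_pos (P.φ a x)) (h3 ▸ P.inner_self_pos _)
  rw [norm_sq]
  refine h4.trans ?_
  rw [norm_smul, mul_pow, norm_sq]
  simp

/-- The inner product on the completion. -/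
noncomputable def complInner : UniformSpace.Completion P →L⋆[ℂ] UniformSpace.Completion P →L[ℂ] B :=
  (LinearMap.mkContinuousOfExistsBound
    { toFun := fun x => (LinearMap.mkContinuous (P.inner x) ‖x‖ (P.norm_inner_le x)).fromCompletion
      map_add' := fun x y => ContinuousLinearMap.fromCompletion_unique _ _ fun z => by simp
      map_smul' := fun c x => ContinuousLinearMap.fromCompletion_unique _ _ fun z => by simp }
    ⟨1, fun x => by
      refine ContinuousLinearMap.opNorm_le_bound _ (by positivity) fun z => ?_
      induction z using UniformSpace.Completion.induction_on with
      | hp => exact isClosed_le (by fun_prop) (by fun_prop)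
      | ih z => simpa using P.norm_inner_le x z⟩ :
    P →L⋆[ℂ] UniformSpace.Completion P →L[ℂ] B).fromCompletion

@[simp]
theorem complInner_coe (x y : P) :
    P.complInner (x : UniformSpace.Completion P) (y : UniformSpace.Completion P) = P.inner x y := by
  simp [complInner]

/-- The right multiplication by `b` on the completion. -/
noncomputable def complRmul (b : B) : UniformSpace.Completion P →L[ℂ] UniformSpace.Completion P :=
  (LinearMap.mkContinuous (P.rmul.flip b) ‖b‖ fun x => by
    rw [mul_comm]; exact P.norm_rmul_le x b).completion

@[simp]
theorem complRmul_coe (x : P) (b : B) :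
    P.complRmul b (x : UniformSpace.Completion P) = (P.rmul x b : P) := by
  simp [complRmul]

/-- The left multiplication by `a` on the completion. -/
noncomputable def complφ (a : A) : UniformSpace.Completion P →L[ℂ] UniformSpace.Completion P :=
  (LinearMap.mkContinuous (P.φ a) ‖a‖ (P.norm_φ_le a)).completion

@[simp]
theorem complφ_coe (x : P) (a : A) :
    P.complφ a (x : UniformSpace.Completion P) = (P.φ a x : P) := by
  simp [complφ]

theorem compl_ext {E : Type*} [TopologicalSpace E] [T2Space E]
    {f g : UniformSpace.Completion P → E} (hf : Continuous f) (hg : Continuous g)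
    (h : ∀ x : P, f x = g x) : f = g :=
  funext fun x => UniformSpace.Completion.induction_on x (isClosed_eq hf hg) h

/-- The right action on the completion as a bilinear map. -/
noncomputable def complRmulₗ :
    UniformSpace.Completion P →ₗ[ℂ] B →ₗ[ℂ] UniformSpace.Completion P :=
  LinearMap.flip
    { toFun := fun b => (P.complRmul b).toLinearMap
      map_add' := fun b c => LinearMap.ext fun x => congrFun (P.compl_ext
        (P.complRmul (b + c)).continuous
        ((P.complRmul b).continuous.add (P.complRmul c).continuous)
        fun x => by simp [UniformSpace.Completion.coe_add]) x
      map_smul' := fun r b => LinearMap.ext fun x => congrFun (P.compl_ext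
        (P.complRmul (r • b)).continuous ((P.complRmul b).continuous.const_smul r)
        fun x => by simp [UniformSpace.Completion.coe_smul]) x }

/-- The left action on the completion as a homomorphism. -/
noncomputable def complφₗ : A →ₙₐ[ℂ] Module.End ℂ (UniformSpace.Completion P) where
  toFun a := (P.complφ a).toLinearMap
  map_add' a b := LinearMap.ext fun x => congrFun (P.compl_ext
    (P.complφ (a + b)).continuous ((P.complφ a).continuous.add (P.complφ b).continuous)
    fun x => by simp [UniformSpace.Completion.coe_add]) x
  map_zero' := LinearMap.ext fun x => congrFun (P.compl_ext
    (P.complφ 0).continuous continuous_const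
    fun x => by simp [UniformSpace.Completion.coe_zero]) x
  map_smul' r a := LinearMap.ext fun x => congrFun (P.compl_ext
    (P.complφ (r • a)).continuous ((P.complφ a).continuous.const_smul r)
    fun x => by simp [UniformSpace.Completion.coe_smul]) x
  map_mul' a b := LinearMap.ext fun x => congrFun (P.compl_ext
    (P.complφ (a * b)).continuous ((P.complφ a).continuous.comp (P.complφ b).continuous)
    fun x => by simp) x

/-- The inner product on the completion as a sesquilinear map. -/
noncomputable def complInnerₗ :
    UniformSpace.Completion P →ₗ⋆[ℂ] UniformSpace.Completion P →ₗ[ℂ] B where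
  toFun x := (P.complInner x).toLinearMap
  map_add' x y := by rw [map_add]; rfl
  map_smul' c x := by rw [map_smulₛₗ]; rfl

theorem compl_rmul_mul (x : UniformSpace.Completion P) (b c : B) :
    P.complRmul (b * c) x = P.complRmul c (P.complRmul b x) :=
  congrFun (P.compl_ext (P.complRmul (b * c)).continuous
    ((P.complRmul c).continuous.comp (P.complRmul b).continuous)
    fun x => by simp [P.rmul_mul]) x

theorem compl_inner_rmul (x y : UniformSpace.Completion P) (b : B) :
    P.complInner x (P.complRmul b y) = P.complInner x y * b := by
  induction x, y using UniformSpace.Completion.induction_on₂ with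
  | hp => exact isClosed_eq (by fun_prop) (by fun_prop)
  | ih x y => simp [P.inner_rmul]

theorem compl_star_inner (x y : UniformSpace.Completion P) :
    star (P.complInner x y) = P.complInner y x := by
  induction x, y using UniformSpace.Completion.induction_on₂ with
  | hp => exact isClosed_eq (by fun_prop) (by fun_prop)
  | ih x y => simp [P.star_inner]

theorem compl_inner_self_pos (x : UniformSpace.Completion P) : CStarPos (P.complInner x x) := by
  induction x using UniformSpace.Completion.induction_on with
  | hp => exact CStarPos.isClosed.preimage (f := fun x => P.complInner x x) (by fun_prop)
  | ih x => simpa using P.inner_self_pos x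

theorem compl_norm_sq (x : UniformSpace.Completion P) : ‖x‖ ^ 2 = ‖P.complInner x x‖ := by
  induction x using UniformSpace.Completion.induction_on with
  | hp => exact isClosed_eq (by fun_prop) (by fun_prop)
  | ih x => simp [P.norm_sq]

theorem compl_inner_φ (a : A) (x y : UniformSpace.Completion P) :
    P.complInner (P.complφ a x) y = P.complInner x (P.complφ (star a) y) := by
  induction x, y using UniformSpace.Completion.induction_on₂ with
  | hp => exact isClosed_eq (by fun_prop) (by fun_prop)
  | ih x y => simp [P.inner_φ]

/-- The correspondence obtained from a pre-correspondence by dividing out the vectors of length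
zero and completing; the operations are the continuous extensions of the given ones. -/
noncomputable def completion : CStarCorrespondence A B where
  carrier := UniformSpace.Completion P
  rmul := P.complRmulₗ
  inner := P.complInnerₗ
  φ := P.complφₗ
  rmul_mul := P.compl_rmul_mul
  inner_rmul := P.compl_inner_rmul
  star_inner := P.compl_star_inner
  inner_self_pos := P.compl_inner_self_pos
  norm_sq := P.compl_norm_sq
  inner_φ := P.compl_inner_φ

end PreCorrespondence

namespace CStarCorrespondence

section basic

variable {A B : Type u} [NonUnitalCStarAlgebra A] [NonUnitalCStarAlgebra B]

instance : CoeSort (CStarCorrespondence A B) (Type u) := ⟨carrier⟩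

variable (X : CStarCorrespondence A B)

instance : NormedAddCommGroup X := X.normedAddCommGroup
instance : NormedSpace ℂ X := X.normedSpace
instance : CompleteSpace X := X.completeSpace

theorem ext_inner {x y : X} (h : ∀ z, X.inner z x = X.inner z y) : x = y := by
  rw [← sub_eq_zero, ← norm_eq_zero, ← sq_eq_zero_iff, X.norm_sq, map_sub, h, sub_self, norm_zero]

/-- The operators `φ a` commute with the right action. -/
theorem φ_rmul (a : A) (x : X) (b : B) : X.φ a (X.rmul x b) = X.rmul (X.φ a x) b := by
  have h : ∀ z w : X, X.inner z (X.φ a w) = X.inner (X.φ (star a) z) w := fun z w => by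
    rw [X.inner_φ, star_star]
  refine X.ext_inner fun z => ?_
  rw [h, X.inner_rmul, X.inner_rmul, h]

end basic

section tensor

variable {A B C : Type u} [NonUnitalCStarAlgebra A] [NonUnitalCStarAlgebra B]
  [NonUnitalCStarAlgebra C]

/-- The `C`-valued form `⟨x₁ ⊗ y₁, x₂ ⊗ y₂⟩ = ⟨y₁, φ(⟨x₁, x₂⟩) y₂⟩` on the algebraic tensor product
over `ℂ`. -/
noncomputable def tensorInner (X : CStarCorrespondence A B) (Y : CStarCorrespondence B C) :
    (X ⊗[ℂ] Y) →ₗ⋆[ℂ] (X ⊗[ℂ] Y) →ₗ[ℂ] C :=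
  TensorProduct.lift (LinearMap.mk₂'ₛₗ (starRingEnd ℂ) (starRingEnd ℂ)
    (fun x₁ y₁ => TensorProduct.lift (LinearMap.mk₂ ℂ
      (fun x₂ y₂ => Y.inner y₁ (Y.φ (X.inner x₁ x₂) y₂))
      (by simp) (by simp) (by simp) (by simp)))
    (fun _ _ _ => TensorProduct.ext' fun _ _ => by simp)
    (fun _ _ _ => TensorProduct.ext' fun _ _ => by simp)
    (fun _ _ _ => TensorProduct.ext' fun _ _ => by simp)
    (fun _ _ _ => TensorProduct.ext' fun _ _ => by simp))

@[simp]
theorem tensorInner_tmul (X : CStarCorrespondence A B) (Y : CStarCorrespondence B C)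
    (x₁ x₂ : X) (y₁ y₂ : Y) :
    tensorInner X Y (x₁ ⊗ₜ y₁) (x₂ ⊗ₜ y₂) = Y.inner y₁ (Y.φ (X.inner x₁ x₂) y₂) := rfl

theorem inner_rmul_left (X : CStarCorrespondence A B) (x y : X) (b : B) :
    X.inner (X.rmul x b) y = star b * X.inner x y := by
  rw [← X.star_inner, X.inner_rmul, star_mul, X.star_inner]

theorem tensorInner_pos (X : CStarCorrespondence A B) (Y : CStarCorrespondence B C)
    (t : X ⊗[ℂ] Y) : CStarPos (tensorInner X Y t t) := by
  obtain ⟨s, rfl⟩ := TensorProduct.exists_finset t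
  obtain ⟨T, hT⟩ := CStarPos.matrix (ι := s) (fun i j => X.inner i.1.1 j.1.1)
    (fun i j => X.star_inner _ _) (fun b => by
      have := X.inner_self_pos (∑ i : s, X.rmul i.1.1 (b i))
      simp only [map_sum, LinearMap.sum_apply, X.inner_rmul, inner_rmul_left] at this
      rwa [Finset.sum_comm] at this)
  have h : tensorInner X Y (∑ i ∈ s, i.1 ⊗ₜ[ℂ] i.2) (∑ i ∈ s, i.1 ⊗ₜ[ℂ] i.2)
      = ∑ k, Y.inner (∑ i : s, Y.φ (T k i) i.1.2) (∑ i : s, Y.φ (T k i) i.1.2) := by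
    rw [← Finset.sum_coe_sort s]
    simp only [map_sum, LinearMap.sum_apply, tensorInner_tmul, hT, Y.inner_φ, map_mul,
      Module.End.mul_apply]
    rw [Finset.sum_comm_cycle]
  rw [h]
  exact CStarPos.sum _ _ fun k _ => Y.inner_self_pos _

/-- The algebraic tensor product with its `C`-valued form and its actions
`(x ⊗ y) · c = x ⊗ (y · c)` and `a · (x ⊗ y) = (φ(a) x) ⊗ y`. -/
noncomputable def preTensor (X : CStarCorrespondence A B) (Y : CStarCorrespondence B C) :
    PreCorrespondence A C where
  carrier := X ⊗[ℂ] Y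
  rmul := LinearMap.mk₂ ℂ (fun t c => (Y.rmul.flip c).lTensor X t)
    (by simp) (by simp)
    (fun t b c => by simp [LinearMap.lTensor_add])
    (fun r t c => by simp [LinearMap.lTensor_smul])
  inner := tensorInner X Y
  φ :=
    { toFun := fun a => (X.φ a).rTensor Y
      map_add' := fun a b => by simp [LinearMap.rTensor_add]
      map_zero' := by simp
      map_smul' := fun r a => by simp [LinearMap.rTensor_smul]
      map_mul' := fun a b => by rw [map_mul, LinearMap.rTensor_mul] }
  rmul_mul t b c := by
    induction t using TensorProduct.induction_on with
    | zero => simp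
    | tmul x y => simp [Y.rmul_mul]
    | add s t hs ht => simp only [map_add, LinearMap.add_apply, hs, ht]
  inner_rmul s t b := by
    induction t using TensorProduct.induction_on with
    | zero => simp
    | add t t' ht ht' => simp only [map_add, LinearMap.add_apply, ht, ht', add_mul]
    | tmul x y =>
      induction s using TensorProduct.induction_on with
      | zero => simp
      | add t t' ht ht' => simp only [map_add, LinearMap.add_apply, ht, ht', add_mul]
      | tmul x' y' => simp [Y.φ_rmul, Y.inner_rmul]
  star_inner s t := by
    induction t using TensorProduct.induction_on with
    | zero => simp
    | add t t' ht ht' => simp only [map_add, LinearMap.add_apply, star_add, ht, ht']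
    | tmul x y =>
      induction s using TensorProduct.induction_on with
      | zero => simp
      | add t t' ht ht' => simp only [map_add, LinearMap.add_apply, star_add, ht, ht']
      | tmul x' y' => simp [Y.star_inner, Y.inner_φ, X.star_inner]
  inner_self_pos := tensorInner_pos X Y
  inner_φ a s t := by
    induction t using TensorProduct.induction_on with
    | zero => simp
    | add t t' ht ht' => simp only [map_add, ht, ht']
    | tmul x y =>
      induction s using TensorProduct.induction_on with
      | zero => simp
      | add t t' ht ht' => simp only [map_add, LinearMap.add_apply, ht, ht']
      | tmul x' y' => simp [X.inner_φ]

/-- The interior tensor product `X ⊗_B Y` of an `A`-`B`-correspondence and a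
`B`-`C`-correspondence. The elements `x b ⊗ y - x ⊗ φ(b) y` have length zero
(`tensor_balanced`), so they vanish in it. -/
noncomputable def tensor (X : CStarCorrespondence A B) (Y : CStarCorrespondence B C) :
    CStarCorrespondence A C :=
  (preTensor X Y).completion

/-- The elementary tensor `x ⊗ y` in the interior tensor product. -/
noncomputable def tmul (X : CStarCorrespondence A B) (Y : CStarCorrespondence B C) (x : X) (y : Y) :
    tensor X Y :=
  let t : preTensor X Y := (x ⊗ₜ[ℂ] y : X ⊗[ℂ] Y)
  (t : UniformSpace.Completion (preTensor X Y))

theorem inner_tmul (X : CStarCorrespondence A B) (Y : CStarCorrespondence B C)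
    (x₁ x₂ : X) (y₁ y₂ : Y) :
    (tensor X Y).inner (tmul X Y x₁ y₁) (tmul X Y x₂ y₂) = Y.inner y₁ (Y.φ (X.inner x₁ x₂) y₂) :=
  (preTensor X Y).complInner_coe (x₁ ⊗ₜ[ℂ] y₁ : X ⊗[ℂ] Y) (x₂ ⊗ₜ[ℂ] y₂ : X ⊗[ℂ] Y)

theorem tensor_balanced (X : CStarCorrespondence A B) (Y : CStarCorrespondence B C)
    (x : X) (b : B) (y : Y) : tmul X Y (X.rmul x b) y = tmul X Y x (Y.φ b y) := by
  rw [← sub_eq_zero, ← norm_eq_zero, ← sq_eq_zero_iff, (tensor X Y).norm_sq]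
  simp only [map_sub, LinearMap.sub_apply, inner_tmul, X.inner_rmul, inner_rmul_left, map_mul,
    Module.End.mul_apply, Y.inner_φ]
  simp

end tensor

section relations

variable {A B : Type u} [NonUnitalCStarAlgebra A] [NonUnitalCStarAlgebra B]

/-- Unitary equivalence `X ≈ Y` of `A`-`B`-correspondences: there is a unitary (that is, a
surjective inner product preserving) bimodule map from `X` to `Y`. -/
def UnitarilyEquivalent (X Y : CStarCorrespondence A B) : Prop :=
  ∃ U : X ≃ₗ[ℂ] Y, (∀ x y, Y.inner (U x) (U y) = X.inner x y) ∧
    (∀ x b, U (X.rmul x b) = Y.rmul (U x) b) ∧ (∀ a x, U (X.φ a x) = Y.φ a (U x))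

/-- `IsLeftInner X l` says that `l` is a left inner product that makes the `A`-`B`-correspondence
`X` a left Hilbert `A`-module (for the left action `φ`) and a Hilbert `A`-`B`-bimodule, i.e.
`l x y · z = x · ⟨y, z⟩`. -/
structure IsLeftInner (X : CStarCorrespondence A B) (l : X →ₗ[ℂ] X →ₗ⋆[ℂ] A) : Prop where
  φ_left : ∀ a x y, l (X.φ a x) y = a * l x y
  star_left : ∀ x y, star (l x y) = l y x
  pos : ∀ x, CStarPos (l x x)
  definite : ∀ x, l x x = 0 → x = 0
  /-- Completeness for the norm `‖l x x‖ ^ (1/2)`. -/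
  complete : ∀ x : ℕ → X,
    (∀ ε > 0, ∃ N, ∀ m ≥ N, ∀ n ≥ N, √‖l (x m - x n) (x m - x n)‖ < ε) →
      ∃ y : X, ∀ ε > 0, ∃ N, ∀ n ≥ N, √‖l (x n - y) (x n - y)‖ < ε
  compat : ∀ x y z, X.φ (l x y) z = X.rmul x (X.inner y z)

/-- An `A`-`B`-imprimitivity bimodule: a Hilbert `A`-`B`-bimodule that is full on both sides, i.e.
the closed linear spans of the values of its two inner products are `A` and `B`. -/
def IsImprimitivityBimodule (X : CStarCorrespondence A B) : Prop :=
  Dense (Submodule.span ℂ {b : B | ∃ x y : X, X.inner x y = b} : Set B) ∧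
    ∃ l : X →ₗ[ℂ] X →ₗ⋆[ℂ] A, IsLeftInner X l ∧
      Dense (Submodule.span ℂ {a : A | ∃ x y : X, l x y = a} : Set A)

/-- `tpowSucc E n` is the interior tensor power `E^{⊗ (n + 1)}`. -/
noncomputable def tpowSucc (E : CStarCorrespondence A A) : ℕ → CStarCorrespondence A A
  | 0 => E
  | n + 1 => tensor (tpowSucc E n) E

/-- Strong Morita equivalence of `E` and `F`: `E ⊗ M ≈ M ⊗ F` for an imprimitivity bimodule `M`. -/
def StrongMoritaEquivalent (E : CStarCorrespondence A A) (F : CStarCorrespondence B B) : Prop :=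
  ∃ M : CStarCorrespondence A B, M.IsImprimitivityBimodule ∧
    UnitarilyEquivalent (tensor E M) (tensor M F)

/-- Elementary strong shift equivalence: `E ≈ R ⊗ S` and `F ≈ S ⊗ R`. -/
def ElementaryStrongShiftEquivalent (E : CStarCorrespondence A A) (F : CStarCorrespondence B B) :
    Prop :=
  ∃ (R : CStarCorrespondence A B) (S : CStarCorrespondence B A),
    UnitarilyEquivalent E (tensor R S) ∧ UnitarilyEquivalent F (tensor S R)

/-- Shift equivalence, with some lag `m = n + 1 ≥ 1`: `E^{⊗ m} ≈ R ⊗ S`, `F^{⊗ m} ≈ S ⊗ R`,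
`S ⊗ E ≈ F ⊗ S` and `E ⊗ R ≈ R ⊗ F`. -/
def ShiftEquivalent (E : CStarCorrespondence A A) (F : CStarCorrespondence B B) : Prop :=
  ∃ (R : CStarCorrespondence A B) (S : CStarCorrespondence B A) (n : ℕ),
    UnitarilyEquivalent (tpowSucc E n) (tensor R S) ∧
    UnitarilyEquivalent (tpowSucc F n) (tensor S R) ∧
    UnitarilyEquivalent (tensor S E) (tensor F S) ∧
    UnitarilyEquivalent (tensor E R) (tensor R F)

end relations

/-- A C*-algebra together with a correspondence over it. -/
structure Over : Type (u + 1) where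
  algebra : Type u
  [cstar : NonUnitalCStarAlgebra algebra]
  corr : CStarCorrespondence algebra algebra

instance (P : Over.{u}) : NonUnitalCStarAlgebra P.algebra := P.cstar

/-- Strong shift equivalence: the transitive closure of elementary strong shift equivalence on the
class of all correspondences over arbitrary C*-algebras. -/
def StrongShiftEquivalent {A B : Type u} [NonUnitalCStarAlgebra A] [NonUnitalCStarAlgebra B]
    (E : CStarCorrespondence A A) (F : CStarCorrespondence B B) : Prop :=
  Relation.TransGen
    (fun P Q : Over.{u} => ElementaryStrongShiftEquivalent P.corr Q.corr) ⟨A, E⟩ ⟨B, F⟩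

end CStarCorrespondence

/-! Up to unitary equivalence the interior tensor product is associative and `A` is a two-sided unit
for it, except that the left unit law `A ⊗ X ≈ X` needs a nondegenerate left action on `X`. The
theorem is an algebraic computation in this calculus, once imprimitivity bimodules are recognised as
the invertible correspondences.

If `M` has inverse `N`, then `E ⊗ M ≈ M ⊗ F` gives `E ≈ (E ⊗ M) ⊗ N` and `F ≈ N ⊗ (E ⊗ M)`, which is
(1) ⇒ (2). An elementary strong shift equivalence is a shift equivalence of lag one, and shift
equivalence is transitive, with lags adding, even through degenerate correspondences; this gives (3)
⇒ (4). For (4) ⇒ (1), the powers of `E` and `F` are invertible, so `E^{⊗m} ≈ R ⊗ S` and `F^{⊗m} ≈ S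
⊗ R` give `R` a right and a left inverse. Hence `R` is invertible, thus an imprimitivity bimodule,
and it already satisfies `E ⊗ R ≈ R ⊗ F`.

The analysis lies in two lemmas. `IsImprimitivityBimodule.exists_isInverse` shows that the conjugate
module is an inverse. Conversely, `IsInverse.isImprimitivityBimodule` turns `R ⊗ S ≈ A` and `S ⊗ R ≈
B` into pairings `u` and `v`, adjusts them to be compatible, and identifies `S` with the conjugate
of `R` through an isometry `J`; the left inner product on `R` is `⟨J x, J y⟩`. Most of the unitaries
come from `exists_isUnitary`: it suffices to compare Gram matrices of total families. -/

/-! ## Total families -/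

section total

variable {V W U : Type*} [NormedAddCommGroup V] [NormedSpace ℂ V] [NormedAddCommGroup W]
  [NormedSpace ℂ W] [NormedAddCommGroup U] [NormedSpace ℂ U] {ι κ : Type*}

/-- A family of vectors is total if its linear span is dense. -/
def TotalFamily (f : ι → V) : Prop := Dense (Submodule.span ℂ (Set.range f) : Set V)

namespace TotalFamily

theorem mem_of_isClosed {f : ι → V} (hf : TotalFamily f) {K : Submodule ℂ V}
    (hK : IsClosed (K : Set V)) (h : ∀ i, f i ∈ K) (x : V) : x ∈ K := by
  have h1 : Submodule.span ℂ (Set.range f) ≤ K := Submodule.span_le.2 (by rintro _ ⟨i, rfl⟩; exact h i)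
  have h2 : closure (Submodule.span ℂ (Set.range f) : Set V) ⊆ K :=
    closure_minimal (fun y hy => h1 hy) hK
  exact h2 (hf x)

theorem of_forall {f : ι → V}
    (h : ∀ K : Submodule ℂ V, IsClosed (K : Set V) → (∀ i, f i ∈ K) → ∀ x, x ∈ K) : TotalFamily f := by
  intro x
  rw [← Submodule.topologicalClosure_coe]
  exact h _ (Submodule.isClosed_topologicalClosure _)
    (fun i => Submodule.le_topologicalClosure _ (Submodule.subset_span (Set.mem_range_self i))) x

theorem trans {f : ι → V} {g : κ → V} (hf : TotalFamily f)
    (h : ∀ K : Submodule ℂ V, IsClosed (K : Set V) → (∀ j, g j ∈ K) → ∀ i, f i ∈ K) : TotalFamily g :=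
  of_forall fun K hK hg => hf.mem_of_isClosed hK (h K hK hg)

theorem of_surjective {f : ι → V} (hf : Function.Surjective f) : TotalFamily f :=
  of_forall fun K _ h x => by obtain ⟨i, rfl⟩ := hf x; exact h i

theorem eq_of_continuous {σ : ℂ →+* ℂ} {f : ι → V} (hf : TotalFamily f) {S T : V →ₛₗ[σ] W}
    (hS : Continuous S) (hT : Continuous T) (h : ∀ i, S (f i) = T (f i)) (x : V) : S x = T x :=
  hf.mem_of_isClosed (K := LinearMap.eqLocus S T) (isClosed_eq hS hT) h x

/-- The image of a total family under a continuous linear map with dense range is total. -/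
theorem map {σ : ℂ →+* ℂ} [RingHomSurjective σ] {f : ι → V} (hf : TotalFamily f) {T : V →ₛₗ[σ] W}
    (hT : Continuous T) (h : TotalFamily T) : TotalFamily fun i => T (f i) :=
  h.trans fun K hK hi x => hf.mem_of_isClosed (K := K.comap T) (hK.preimage hT) hi x

/-- A separately continuous bilinear map with total values maps pairs of total families to a total
family. -/
theorem map₂ {f : ι → V} {g : κ → W} (hf : TotalFamily f) (hg : TotalFamily g) (T : V →ₗ[ℂ] W →ₗ[ℂ] U)
    (h₁ : ∀ w, Continuous fun v => T v w) (h₂ : ∀ v, Continuous fun w => T v w)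
    (h : TotalFamily fun p : V × W => T p.1 p.2) : TotalFamily fun p : ι × κ => T (f p.1) (g p.2) :=
  h.trans fun K hK hi p =>
    hg.mem_of_isClosed (K := K.comap (T p.1)) (hK.preimage (h₂ p.1))
      (fun j => hf.mem_of_isClosed (K := K.comap (T.flip (g j))) (hK.preimage (h₁ (g j)))
        (fun i => hi (i, j)) p.1) p.2

end TotalFamily

end total

namespace CStarCorrespondence

/-! ### Norm estimates, continuity of the operations, and density of elementary tensors. -/

section estimates

variable {A B C : Type u} [NonUnitalCStarAlgebra A] [NonUnitalCStarAlgebra B]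
  [NonUnitalCStarAlgebra C] (X : CStarCorrespondence A B) (Y : CStarCorrespondence B C)

/-- A correspondence, regarded as a pre-correspondence. -/
def toPre : PreCorrespondence A B where
  carrier := X.carrier
  rmul := X.rmul
  inner := X.inner
  φ := X.φ
  rmul_mul := X.rmul_mul
  inner_rmul := X.inner_rmul
  star_inner := X.star_inner
  inner_self_pos := X.inner_self_pos
  inner_φ := X.inner_φ

theorem norm_eq_sqrt (x : X) : ‖x‖ = √‖X.inner x x‖ := by
  rw [← X.norm_sq, Real.sqrt_sq (norm_nonneg _)]

theorem norm_inner_le (x y : X) : ‖X.inner x y‖ ≤ ‖x‖ * ‖y‖ := by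
  rw [norm_eq_sqrt, norm_eq_sqrt]
  exact X.toPre.norm_inner_le x y

theorem norm_rmul_le (x : X) (b : B) : ‖X.rmul x b‖ ≤ ‖x‖ * ‖b‖ := by
  rw [norm_eq_sqrt, norm_eq_sqrt]
  exact X.toPre.norm_rmul_le x b

theorem norm_φ_le (a : A) (x : X) : ‖X.φ a x‖ ≤ ‖a‖ * ‖x‖ := by
  rw [norm_eq_sqrt, norm_eq_sqrt]
  exact X.toPre.norm_φ_le a x

theorem ext_inner_left {x y : X} (h : ∀ z, X.inner x z = X.inner y z) : x = y :=
  X.ext_inner fun z => by rw [← X.star_inner, h, X.star_inner]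

theorem continuous_inner_right (x : X) : Continuous fun y => X.inner x y :=
  ((X.inner x).mkContinuous ‖x‖ (X.norm_inner_le x)).continuous

theorem continuous_inner_left (y : X) : Continuous fun x => X.inner x y := by
  have := (X.continuous_inner_right y).star
  simpa only [X.star_inner] using this

theorem continuous_rmul_right (x : X) : Continuous fun b => X.rmul x b :=
  ((X.rmul x).mkContinuous ‖x‖ (X.norm_rmul_le x)).continuous

theorem continuous_rmul_left (b : B) : Continuous fun x => X.rmul x b :=
  ((X.rmul.flip b).mkContinuous ‖b‖ fun x => by
    rw [mul_comm]; exact X.norm_rmul_le x b).continuous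

theorem continuous_φ_right (a : A) : Continuous fun x => X.φ a x :=
  ((X.φ a).mkContinuous ‖a‖ (X.norm_φ_le a)).continuous

/-- The left action as a bilinear map. -/
def φₗ : A →ₗ[ℂ] X →ₗ[ℂ] X := LinearMap.mk₂ ℂ (fun a x => X.φ a x) (by simp) (by simp) (by simp)
  (by simp)

theorem continuous_φ_left (x : X) : Continuous fun a => X.φ a x :=
  ((X.φₗ.flip x).mkContinuous ‖x‖ fun a => by
    rw [mul_comm]; exact X.norm_φ_le a x).continuous

theorem φ_mul (a a' : A) (x : X) : X.φ (a * a') x = X.φ a (X.φ a' x) := by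
  rw [map_mul]; rfl

/-- The elementary tensors as a bilinear map. -/
noncomputable def tmulₗ : X →ₗ[ℂ] Y →ₗ[ℂ] tensor X Y :=
  LinearMap.compr₂ (TensorProduct.mk ℂ X Y)
    { toFun := fun t => ((show preTensor X Y from t : preTensor X Y) :
        UniformSpace.Completion (preTensor X Y))
      map_add' := fun s t => UniformSpace.Completion.coe_add (α := preTensor X Y) s t
      map_smul' := fun c t => UniformSpace.Completion.coe_smul (X := preTensor X Y) c t }

theorem φ_tmul (a : A) (x : X) (y : Y) :
    (tensor X Y).φ a (tmul X Y x y) = tmul X Y (X.φ a x) y :=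
  (preTensor X Y).complφ_coe (x ⊗ₜ[ℂ] y : X ⊗[ℂ] Y) a

theorem total_tmul : TotalFamily fun p : X × Y => tmul X Y p.1 p.2 := by
  refine TotalFamily.of_forall fun K hK h z => ?_
  induction z using UniformSpace.Completion.induction_on with
  | hp => exact hK
  | ih t =>
    induction t using TensorProduct.induction_on with
    | zero => exact K.zero_mem
    | tmul x y => exact h (x, y)
    | add s t hs ht =>
      exact (congrArg (· ∈ K) (UniformSpace.Completion.coe_add (α := preTensor X Y) s t)).mpr
        (K.add_mem hs ht)

theorem norm_tmul_le (x : X) (y : Y) : ‖tmul X Y x y‖ ≤ ‖x‖ * ‖y‖ := by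
  refine le_of_sq_le_sq ?_ (by positivity)
  rw [(tensor X Y).norm_sq, inner_tmul, mul_pow, X.norm_sq]
  calc _ ≤ ‖y‖ * ‖Y.φ (X.inner x x) y‖ := Y.norm_inner_le _ _
    _ ≤ ‖y‖ * (‖X.inner x x‖ * ‖y‖) := by gcongr; exact Y.norm_φ_le _ _
    _ = _ := by ring

theorem continuous_tmul_right (x : X) : Continuous fun y => tmul X Y x y :=
  ((tmulₗ X Y x).mkContinuous ‖x‖ (norm_tmul_le X Y x)).continuous

theorem continuous_tmul_left (y : Y) : Continuous fun x => tmul X Y x y :=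
  (((tmulₗ X Y).flip y).mkContinuous ‖y‖ fun x => by
    rw [mul_comm]; exact norm_tmul_le X Y x y).continuous

/-- The module is nondegenerate over the right algebra. -/
theorem total_rmul : TotalFamily fun p : X × B => X.rmul p.1 p.2 := by
  let _ := CStarAlgebra.spectralOrder B
  have := CStarAlgebra.spectralOrderedRing B
  have hu := CStarAlgebra.increasingApproximateUnit B
  refine TotalFamily.of_forall fun K hK h x => ?_
  -- With `g = ⟨x, x⟩` and `e` self-adjoint of norm at most one, `‖x e - x‖² = ‖e (g e - g) - (g e -
  -- g)‖ ≤ 2 ‖g e - g‖`, which tends to zero along the approximate unit.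
  have hlim : Filter.Tendsto (fun e => X.rmul x e) (CStarAlgebra.approximateUnit B) (nhds x) := by
    rw [tendsto_iff_norm_sub_tendsto_zero]
    have h1 : Filter.Tendsto (fun e : B => 2 * ‖X.inner x x * e - X.inner x x‖)
        (CStarAlgebra.approximateUnit B) (nhds 0) := by
      have := (tendsto_iff_norm_sub_tendsto_zero.1 (hu.tendsto_mul_left (X.inner x x))).const_mul 2
      simpa using this
    have h2 : Filter.Tendsto (fun e : B => √(2 * ‖X.inner x x * e - X.inner x x‖))
        (CStarAlgebra.approximateUnit B) (nhds 0) := by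
      simpa using h1.sqrt
    refine squeeze_zero' (Filter.Eventually.of_forall fun e => norm_nonneg _) ?_ h2
    filter_upwards [hu.eventually_norm, hu.eventually_star_eq] with e he hs
    rw [X.norm_eq_sqrt]
    refine Real.sqrt_le_sqrt ?_
    have h3 : X.inner (X.rmul x e - x) (X.rmul x e - x)
        = e * (X.inner x x * e - X.inner x x) - (X.inner x x * e - X.inner x x) := by
      simp only [map_sub, LinearMap.sub_apply, X.inner_rmul, inner_rmul_left, hs, mul_sub,
        mul_assoc]
      abel
    rw [h3]
    refine (norm_sub_le _ _).trans ?_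
    have h4 := norm_mul_le e (X.inner x x * e - X.inner x x)
    nlinarith [norm_nonneg (X.inner x x * e - X.inner x x)]
  exact hK.mem_of_tendsto hlim (Filter.Eventually.of_forall fun e => h (x, e))

end estimates

/-! ### Unitaries determined by Gram matrices. -/

section unitary

variable {A B C : Type u} [NonUnitalCStarAlgebra A] [NonUnitalCStarAlgebra B]
  [NonUnitalCStarAlgebra C]

/-- A unitary bimodule map. -/
structure IsUnitary {X Y : CStarCorrespondence A B} (U : X ≃ₗ[ℂ] Y) : Prop where
  inner : ∀ x y, Y.inner (U x) (U y) = X.inner x y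
  φ : ∀ a x, U (X.φ a x) = Y.φ a (U x)

namespace IsUnitary

variable {X Y : CStarCorrespondence A B} {U : X ≃ₗ[ℂ] Y} (hU : IsUnitary U)

include hU

theorem norm (x : X) : ‖U x‖ = ‖x‖ := by rw [Y.norm_eq_sqrt, hU.inner, X.norm_eq_sqrt]

theorem continuous : Continuous U :=
  AddMonoidHomClass.continuous_of_bound U 1 fun x => by rw [hU.norm, one_mul]

/-- Right linearity is automatic for a surjection that preserves inner products, so `IsUnitary` does
not ask for it. -/
theorem rmul (x : X) (b : B) : U (X.rmul x b) = Y.rmul (U x) b := by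
  refine Y.ext_inner fun z => ?_
  obtain ⟨z, rfl⟩ := U.surjective z
  rw [hU.inner, X.inner_rmul, Y.inner_rmul, hU.inner]

theorem unitarilyEquivalent : UnitarilyEquivalent X Y := ⟨U, hU.inner, hU.rmul, hU.φ⟩

end IsUnitary

/-- Two total families with the same Gram matrices and compatible left actions are related by a
unitary bimodule map. -/
theorem exists_isUnitary {ι : Type*} {X Y : CStarCorrespondence A B} {f : ι → X} {g : ι → Y}
    (hf : TotalFamily f) (hg : TotalFamily g) (h : ∀ i j, X.inner (f i) (f j) = Y.inner (g i) (g j))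
    (hφ : ∀ a i, ∃ j, X.φ a (f i) = f j ∧ Y.φ a (g i) = g j) :
    ∃ U : X ≃ₗ[ℂ] Y, IsUnitary U ∧ ∀ i, U (f i) = g i := by
  -- Equal Gram matrices give formal linear combinations the same norm on both sides, so the
  -- correspondence of vectors is well defined on dense subspaces and extends to a surjective
  -- isometry.
  let F : (ι →₀ ℂ) →ₗ[ℂ] X := Finsupp.linearCombination ℂ f
  let G : (ι →₀ ℂ) →ₗ[ℂ] Y := Finsupp.linearCombination ℂ g
  have hF : DenseRange F := by
    have : Set.range F = (LinearMap.range F : Set X) := rfl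
    rw [DenseRange, this, Finsupp.range_linearCombination]
    exact hf
  have hG : DenseRange G := by
    have : Set.range G = (LinearMap.range G : Set Y) := rfl
    rw [DenseRange, this, Finsupp.range_linearCombination]
    exact hg
  have hFG : ∀ u v, Y.inner (G u) (G v) = X.inner (F u) (F v) := fun u v => by
    simp only [F, G, Finsupp.linearCombination_apply, Finsupp.sum, map_sum, LinearMap.sum_apply,
      map_smul, LinearMap.map_smulₛₗ, LinearMap.smul_apply, h]
  have hn : ∀ u, ‖G u‖ = ‖F u‖ := fun u => by rw [Y.norm_eq_sqrt, hFG, X.norm_eq_sqrt]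
  let U := (LinearEquiv.refl ℂ (ι →₀ ℂ)).extendOfIsometry F G hF hG hn
  have hUF : ∀ u, U (F u) = G u := fun u =>
    LinearEquiv.extendOfIsometry_eq (LinearEquiv.refl ℂ (ι →₀ ℂ)) F G hF hG hn u
  have hUf : ∀ i, U (f i) = g i := fun i => by
    have := hUF (Finsupp.single i 1)
    simpa [F, G] using this
  refine ⟨U.toLinearEquiv, ⟨fun x y => ?_, fun a x => ?_⟩, hUf⟩
  · change Y.inner (U x) (U y) = _
    have h1 : ∀ u, Y.inner (G u) (U y) = X.inner (F u) y := fun u => by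
      refine hf.eq_of_continuous (S := Y.inner (G u) ∘ₗ U.toLinearEquiv.toLinearMap)
        (T := X.inner (F u)) ((Y.continuous_inner_right _).comp U.continuous)
        (X.continuous_inner_right _) (fun i => ?_) y
      have := hFG u (Finsupp.single i 1)
      simpa [F, G, hUf] using this
    refine hF.induction_on (p := fun x => Y.inner (U x) (U y) = X.inner x y) x
      (isClosed_eq ((Y.continuous_inner_left _).comp U.continuous) (X.continuous_inner_left _))
      fun u => ?_
    rw [hUF, h1]
  · change U _ = Y.φ a (U x)
    refine hf.eq_of_continuous (S := U.toLinearEquiv.toLinearMap ∘ₗ X.φ a)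
      (T := Y.φ a ∘ₗ U.toLinearEquiv.toLinearMap) (U.continuous.comp (X.continuous_φ_right a))
      ((Y.continuous_φ_right a).comp U.continuous) (fun i => ?_) x
    obtain ⟨j, h1, h2⟩ := hφ a i
    change U (X.φ a (f i)) = Y.φ a (U (f i))
    rw [h1, hUf, hUf, h2]

theorem unitarilyEquivalent_of_gram {ι : Type*} {X Y : CStarCorrespondence A B} {f : ι → X}
    {g : ι → Y} (hf : TotalFamily f) (hg : TotalFamily g)
    (h : ∀ i j, X.inner (f i) (f j) = Y.inner (g i) (g j))
    (hφ : ∀ a i, ∃ j, X.φ a (f i) = f j ∧ Y.φ a (g i) = g j) : UnitarilyEquivalent X Y := by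
  obtain ⟨U, hU, -⟩ := exists_isUnitary hf hg h hφ
  exact hU.unitarilyEquivalent

end unitary

local infix:50 " ≅ᵤ " => UnitarilyEquivalent
local infixr:70 " ⊠ " => tensor

/-! ## The calculus of interior tensor products -/

section calculus

variable {A B C D : Type u} [NonUnitalCStarAlgebra A] [NonUnitalCStarAlgebra B]
  [NonUnitalCStarAlgebra C] [NonUnitalCStarAlgebra D]

theorem UnitarilyEquivalent.exists_isUnitary {X Y : CStarCorrespondence A B} (h : X ≅ᵤ Y) :
    ∃ U : X ≃ₗ[ℂ] Y, IsUnitary U := by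
  obtain ⟨U, h1, -, h2⟩ := h
  exact ⟨U, h1, h2⟩

@[refl]
theorem UnitarilyEquivalent.refl (X : CStarCorrespondence A B) : X ≅ᵤ X :=
  ⟨LinearEquiv.refl ℂ X, fun _ _ => rfl, fun _ _ => rfl, fun _ _ => rfl⟩

@[symm]
theorem UnitarilyEquivalent.symm {X Y : CStarCorrespondence A B} (h : X ≅ᵤ Y) : Y ≅ᵤ X := by
  obtain ⟨U, hU⟩ := h.exists_isUnitary
  refine IsUnitary.unitarilyEquivalent (U := U.symm) ⟨fun x y => ?_, fun a x => ?_⟩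
  · rw [← hU.inner, U.apply_symm_apply, U.apply_symm_apply]
  · rw [U.symm_apply_eq, hU.φ, U.apply_symm_apply]

@[trans]
theorem UnitarilyEquivalent.trans {X Y Z : CStarCorrespondence A B} (h : X ≅ᵤ Y) (h' : Y ≅ᵤ Z) :
    X ≅ᵤ Z := by
  obtain ⟨U, hU⟩ := h.exists_isUnitary
  obtain ⟨V, hV⟩ := h'.exists_isUnitary
  refine IsUnitary.unitarilyEquivalent (U := U.trans V) ⟨fun x y => ?_, fun a x => ?_⟩
  · simp only [LinearEquiv.trans_apply, hV.inner, hU.inner]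
  · simp only [LinearEquiv.trans_apply, hU.φ, hV.φ]

instance : Trans (UnitarilyEquivalent (A := A) (B := B)) UnitarilyEquivalent
    UnitarilyEquivalent := ⟨UnitarilyEquivalent.trans⟩

/-- The interior tensor product is a functor of both variables. -/
theorem tensor_congr {X X' : CStarCorrespondence A B} {Y Y' : CStarCorrespondence B C}
    (h : X ≅ᵤ X') (h' : Y ≅ᵤ Y') : X ⊠ Y ≅ᵤ X' ⊠ Y' := by
  obtain ⟨U, hU⟩ := h.exists_isUnitary
  obtain ⟨V, hV⟩ := h'.exists_isUnitary
  refine unitarilyEquivalent_of_gram (f := fun p : X × Y => tmul X Y p.1 p.2)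
    (g := fun p : X × Y => tmul X' Y' (U p.1) (V p.2)) (total_tmul X Y) ?_ ?_ ?_
  · refine (total_tmul X' Y').trans fun K _ hK p => ?_
    simpa using hK (U.symm p.1, V.symm p.2)
  · rintro ⟨x, y⟩ ⟨x', y'⟩
    simp only [inner_tmul, hU.inner, ← hV.φ, hV.inner]
  · rintro a ⟨x, y⟩
    exact ⟨(X.φ a x, y), by simp only [φ_tmul], by simp only [φ_tmul, hU.φ]⟩

theorem tensor_congr_left {X X' : CStarCorrespondence A B} (h : X ≅ᵤ X')
    (Y : CStarCorrespondence B C) : X ⊠ Y ≅ᵤ X' ⊠ Y := tensor_congr h (.refl Y)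

theorem tensor_congr_right (X : CStarCorrespondence A B) {Y Y' : CStarCorrespondence B C}
    (h : Y ≅ᵤ Y') : X ⊠ Y ≅ᵤ X ⊠ Y' := tensor_congr (.refl X) h

/-- The vectors `x ⊗ y ⊗ z` are total on both sides, with the same Gram matrix `⟨z, ⟨y, ⟨x, x'⟩ y'⟩
z'⟩`. -/
theorem tensor_assoc (X : CStarCorrespondence A B) (Y : CStarCorrespondence B C)
    (Z : CStarCorrespondence C D) : (X ⊠ Y) ⊠ Z ≅ᵤ X ⊠ (Y ⊠ Z) := by
  refine unitarilyEquivalent_of_gram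
    (f := fun p : (X × Y) × Z => tmul (X ⊠ Y) Z (tmul X Y p.1.1 p.1.2) p.2)
    (g := fun p : (X × Y) × Z => tmul X (Y ⊠ Z) p.1.1 (tmul Y Z p.1.2 p.2)) ?_ ?_ ?_ ?_
  · exact (total_tmul X Y).map₂ (.of_surjective Function.surjective_id) (tmulₗ (X ⊠ Y) Z)
      (continuous_tmul_left _ _) (continuous_tmul_right _ _) (total_tmul _ _)
  · have := TotalFamily.map₂ (f := (id : X → X)) (.of_surjective Function.surjective_id)
      (total_tmul Y Z) (tmulₗ X (Y ⊠ Z))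
      (continuous_tmul_left _ _) (continuous_tmul_right _ _) (total_tmul _ _)
    exact this.trans fun K _ hK p => hK ((p.1, p.2.1), p.2.2)
  · rintro ⟨⟨x, y⟩, z⟩ ⟨⟨x', y'⟩, z'⟩
    simp only [inner_tmul, φ_tmul]
  · rintro a ⟨⟨x, y⟩, z⟩
    exact ⟨((X.φ a x, y), z), by simp only [φ_tmul], by simp only [φ_tmul]⟩

/-- The C*-algebra `A` as a correspondence over itself. -/
noncomputable def idCorr (A : Type u) [NonUnitalCStarAlgebra A] : CStarCorrespondence A A where
  carrier := A
  rmul := LinearMap.mul ℂ A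
  inner := LinearMap.mk₂'ₛₗ (starRingEnd ℂ) (RingHom.id ℂ) (fun a b => star a * b)
    (fun a a' b => by rw [star_add, add_mul])
    (fun c a b => by rw [star_smul, smul_mul_assoc]; rfl)
    (fun a b b' => mul_add _ _ _)
    (fun c a b => mul_smul_comm _ _ _)
  φ := NonUnitalAlgHom.lmul ℂ A
  rmul_mul x b c := (mul_assoc x b c).symm
  inner_rmul x y b := (mul_assoc _ _ _).symm
  star_inner x y := by
    change star (star x * y) = star y * x
    rw [star_mul, star_star]
  inner_self_pos x := ⟨x, rfl⟩
  norm_sq x := by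
    change ‖x‖ ^ 2 = ‖star x * x‖
    rw [CStarRing.norm_star_mul_self, sq]
  inner_φ a x y := by
    change star (a * x) * y = star x * (star a * y)
    rw [star_mul, mul_assoc]

/-- The left action is nondegenerate. -/
def LeftNondegenerate (X : CStarCorrespondence A B) : Prop :=
  TotalFamily fun p : A × X => X.φ p.1 p.2

theorem total_mul (A : Type u) [NonUnitalCStarAlgebra A] :
    TotalFamily fun p : A × A => p.1 * p.2 :=
  (idCorr A).total_rmul

theorem LeftNondegenerate.congr {X Y : CStarCorrespondence A B} (hX : X.LeftNondegenerate)
    (h : X ≅ᵤ Y) : Y.LeftNondegenerate := by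
  obtain ⟨U, hU⟩ := h.exists_isUnitary
  refine (hX.map (T := U.toLinearMap) hU.continuous (.of_surjective U.surjective)).trans
    fun K _ hK p => ?_
  have := hK (p.1, U p.2)
  simpa [hU.φ] using this

theorem LeftNondegenerate.tensor {X : CStarCorrespondence A B} (hX : X.LeftNondegenerate)
    (Y : CStarCorrespondence B C) : (X ⊠ Y).LeftNondegenerate := by
  refine (hX.map₂ (g := (id : Y → Y)) (.of_surjective Function.surjective_id) (tmulₗ X Y)
    (continuous_tmul_left _ _) (continuous_tmul_right _ _) (total_tmul X Y)).trans
    fun K _ hK p => ?_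
  have := hK (p.1.1, tmul X Y p.1.2 p.2)
  rwa [φ_tmul] at this

theorem leftNondegenerate_idCorr (A : Type u) [NonUnitalCStarAlgebra A] :
    (idCorr A).LeftNondegenerate :=
  total_mul A

/-- The unitary is `x ⊗ b ↦ x b`. It is always onto, because a Hilbert module is nondegenerate over
its coefficient algebra. -/
theorem tensor_idCorr (X : CStarCorrespondence A B) : X ⊠ idCorr B ≅ᵤ X := by
  refine unitarilyEquivalent_of_gram (f := fun p : X × B => tmul X (idCorr B) p.1 p.2)
    (g := fun p : X × B => X.rmul p.1 p.2) (total_tmul X (idCorr B)) X.total_rmul ?_ ?_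
  · rintro ⟨x, b⟩ ⟨x', b'⟩
    refine (inner_tmul X (idCorr B) x x' b b').trans ?_
    rw [X.inner_rmul, inner_rmul_left]
    exact (mul_assoc _ _ _).symm
  · rintro a ⟨x, b⟩
    exact ⟨(X.φ a x, b), φ_tmul X (idCorr B) a x b, X.φ_rmul _ _ _⟩

/-- The unitary is `a ⊗ x ↦ a x`. Its range is the closed span of `A X`, whence the hypothesis. -/
theorem idCorr_tensor {X : CStarCorrespondence A B} (hX : X.LeftNondegenerate) :
    idCorr A ⊠ X ≅ᵤ X := by
  refine unitarilyEquivalent_of_gram (f := fun p : A × X => tmul (idCorr A) X p.1 p.2)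
    (g := fun p : A × X => X.φ p.1 p.2) (total_tmul (idCorr A) X) hX ?_ ?_
  · rintro ⟨a, x⟩ ⟨a', x'⟩
    refine (inner_tmul (idCorr A) X a a' x x').trans ?_
    rw [X.inner_φ, ← X.φ_mul]
    rfl
  · rintro b ⟨a, x⟩
    exact ⟨(b * a, x), φ_tmul (idCorr A) X b a x, (X.φ_mul _ _ _).symm⟩

/-- `N` is inverse to `M` for the interior tensor product. -/
def IsInverse (M : CStarCorrespondence A B) (N : CStarCorrespondence B A) : Prop :=
  M ⊠ N ≅ᵤ idCorr A ∧ N ⊠ M ≅ᵤ idCorr B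

theorem IsInverse.symm {M : CStarCorrespondence A B} {N : CStarCorrespondence B A}
    (h : IsInverse M N) : IsInverse N M := ⟨h.2, h.1⟩

theorem tensor_tensor_idCorr {M : CStarCorrespondence A B} {N : CStarCorrespondence B A}
    {P : CStarCorrespondence B C} {Q : CStarCorrespondence C B} (h : M ⊠ N ≅ᵤ idCorr A)
    (h' : P ⊠ Q ≅ᵤ idCorr B) : (M ⊠ P) ⊠ (Q ⊠ N) ≅ᵤ idCorr A :=
  calc (M ⊠ P) ⊠ (Q ⊠ N) ≅ᵤ ((M ⊠ P) ⊠ Q) ⊠ N := (tensor_assoc _ _ _).symm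
    _ ≅ᵤ (M ⊠ (P ⊠ Q)) ⊠ N := tensor_congr_left (tensor_assoc _ _ _) _
    _ ≅ᵤ (M ⊠ idCorr B) ⊠ N := tensor_congr_left (tensor_congr_right _ h') _
    _ ≅ᵤ M ⊠ N := tensor_congr_left (tensor_idCorr _) _
    _ ≅ᵤ idCorr A := h

theorem IsInverse.tensor {M : CStarCorrespondence A B} {N : CStarCorrespondence B A}
    {P : CStarCorrespondence B C} {Q : CStarCorrespondence C B} (h : IsInverse M N)
    (h' : IsInverse P Q) : IsInverse (M ⊠ P) (Q ⊠ N) :=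
  ⟨tensor_tensor_idCorr h.1 h'.1, tensor_tensor_idCorr h'.2 h.2⟩

/-- Here `A ⊗ M ≈ M ⊗ N ⊗ M ≈ M ⊗ B ≈ M` uses only the right unit law, and the left factor `A` makes
`A ⊗ M` nondegenerate. -/
theorem IsInverse.leftNondegenerate {M : CStarCorrespondence A B} {N : CStarCorrespondence B A}
    (h : IsInverse M N) : M.LeftNondegenerate := by
  refine ((leftNondegenerate_idCorr A).tensor M).congr ?_
  calc idCorr A ⊠ M ≅ᵤ (M ⊠ N) ⊠ M := tensor_congr_left h.1.symm _
    _ ≅ᵤ M ⊠ (N ⊠ M) := tensor_assoc _ _ _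
    _ ≅ᵤ M ⊠ idCorr B := tensor_congr_right _ h.2
    _ ≅ᵤ M := tensor_idCorr M

/-- A left inverse and a left nondegenerate right inverse make a correspondence invertible. -/
theorem isInverse_of_left_of_right {R : CStarCorrespondence A B} {X Y : CStarCorrespondence B A}
    (hX : R ⊠ X ≅ᵤ idCorr A) (hY : Y ⊠ R ≅ᵤ idCorr B) (h : X.LeftNondegenerate) :
    IsInverse R X := by
  refine ⟨hX, ?_⟩
  -- The usual uniqueness of inverses, `X = (Y R) X = Y (R X) = Y`; nondegeneracy of `X` serves only
  -- for the left unit law.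
  have : X ≅ᵤ Y :=
    calc X ≅ᵤ idCorr B ⊠ X := (idCorr_tensor h).symm
      _ ≅ᵤ (Y ⊠ R) ⊠ X := tensor_congr_left hY.symm _
      _ ≅ᵤ Y ⊠ (R ⊠ X) := tensor_assoc _ _ _
      _ ≅ᵤ Y ⊠ idCorr A := tensor_congr_right _ hX
      _ ≅ᵤ Y := tensor_idCorr Y
  exact (tensor_congr_left this R).trans hY

/-- The index is one less than the exponent: `(n + 1) + (k + 1) = (n + k + 1) + 1`. -/
theorem tpowSucc_tensor_tpowSucc (E : CStarCorrespondence A A) (n k : ℕ) :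
    tpowSucc E n ⊠ tpowSucc E k ≅ᵤ tpowSucc E (n + k + 1) := by
  induction k with
  | zero => exact .refl _
  | succ k ih => exact (tensor_assoc _ _ _).symm.trans (tensor_congr_left ih E)

theorem tpowSucc_tensor_comm {E : CStarCorrespondence A A} {F : CStarCorrespondence B B}
    {R : CStarCorrespondence A B} (h : E ⊠ R ≅ᵤ R ⊠ F) (n : ℕ) :
    tpowSucc E n ⊠ R ≅ᵤ R ⊠ tpowSucc F n := by
  induction n with
  | zero => exact h
  | succ n ih =>
    calc (tpowSucc E n ⊠ E) ⊠ R ≅ᵤ tpowSucc E n ⊠ (E ⊠ R) := tensor_assoc _ _ _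
      _ ≅ᵤ tpowSucc E n ⊠ (R ⊠ F) := tensor_congr_right _ h
      _ ≅ᵤ (tpowSucc E n ⊠ R) ⊠ F := (tensor_assoc _ _ _).symm
      _ ≅ᵤ (R ⊠ tpowSucc F n) ⊠ F := tensor_congr_left ih F
      _ ≅ᵤ R ⊠ (tpowSucc F n ⊠ F) := tensor_assoc _ _ _

theorem IsInverse.tpowSucc {E E' : CStarCorrespondence A A} (h : IsInverse E E') (n : ℕ) :
    ∃ P, IsInverse (tpowSucc E n) P := by
  induction n with
  | zero => exact ⟨E', h⟩
  | succ n ih =>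
    obtain ⟨P, hP⟩ := ih
    exact ⟨E' ⊠ P, hP.tensor h⟩

end calculus

/-! ## Shift equivalences -/

section shift

variable {A B C : Type u} [NonUnitalCStarAlgebra A] [NonUnitalCStarAlgebra B]
  [NonUnitalCStarAlgebra C] {E : CStarCorrespondence A A} {F : CStarCorrespondence B B}
  {G : CStarCorrespondence C C}

/-- The intertwining relations are rebracketings: `S ⊗ E ≈ S ⊗ R ⊗ S ≈ F ⊗ S`, and likewise for `R`.
The index `0` means lag one. -/
theorem ElementaryStrongShiftEquivalent.shiftEquivalent
    (h : ElementaryStrongShiftEquivalent E F) : ShiftEquivalent E F := by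
  obtain ⟨R, S, hE, hF⟩ := h
  refine ⟨R, S, 0, hE, hF, ?_, ?_⟩
  · calc S ⊠ E ≅ᵤ S ⊠ (R ⊠ S) := tensor_congr_right S hE
      _ ≅ᵤ (S ⊠ R) ⊠ S := (tensor_assoc _ _ _).symm
      _ ≅ᵤ F ⊠ S := tensor_congr_left hF.symm S
  · calc E ⊠ R ≅ᵤ (R ⊠ S) ⊠ R := tensor_congr_left hE R
      _ ≅ᵤ R ⊠ (S ⊠ R) := tensor_assoc _ _ _
      _ ≅ᵤ R ⊠ F := tensor_congr_right R hF.symm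

/-- The inner factor `R' ⊗ S'` is a power of `F`, which moves to the left past `R` as the same power
of `E` and merges with `R ⊗ S`. -/
theorem tensor_tensor_tpowSucc {R : CStarCorrespondence A B} {R' : CStarCorrespondence B C}
    {S : CStarCorrespondence B A} {S' : CStarCorrespondence C B} {n k : ℕ}
    (h : tpowSucc E n ≅ᵤ R ⊠ S) (h' : tpowSucc F k ≅ᵤ R' ⊠ S') (hR : E ⊠ R ≅ᵤ R ⊠ F) :
    tpowSucc E (k + n + 1) ≅ᵤ (R ⊠ R') ⊠ (S' ⊠ S) := by
  symm
  calc (R ⊠ R') ⊠ (S' ⊠ S) ≅ᵤ ((R ⊠ R') ⊠ S') ⊠ S := (tensor_assoc _ _ _).symm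
    _ ≅ᵤ (R ⊠ (R' ⊠ S')) ⊠ S := tensor_congr_left (tensor_assoc _ _ _) S
    _ ≅ᵤ (R ⊠ tpowSucc F k) ⊠ S := tensor_congr_left (tensor_congr_right R h'.symm) S
    _ ≅ᵤ (tpowSucc E k ⊠ R) ⊠ S := tensor_congr_left (tpowSucc_tensor_comm hR k).symm S
    _ ≅ᵤ tpowSucc E k ⊠ (R ⊠ S) := tensor_assoc _ _ _
    _ ≅ᵤ tpowSucc E k ⊠ tpowSucc E n := tensor_congr_right _ h.symm
    _ ≅ᵤ tpowSucc E (k + n + 1) := tpowSucc_tensor_tpowSucc E k n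

theorem tensor_comm_trans {R : CStarCorrespondence A B} {R' : CStarCorrespondence B C}
    (h : E ⊠ R ≅ᵤ R ⊠ F) (h' : F ⊠ R' ≅ᵤ R' ⊠ G) : E ⊠ (R ⊠ R') ≅ᵤ (R ⊠ R') ⊠ G :=
  calc E ⊠ (R ⊠ R') ≅ᵤ (E ⊠ R) ⊠ R' := (tensor_assoc _ _ _).symm
    _ ≅ᵤ (R ⊠ F) ⊠ R' := tensor_congr_left h R'
    _ ≅ᵤ R ⊠ (F ⊠ R') := tensor_assoc _ _ _
    _ ≅ᵤ R ⊠ (R' ⊠ G) := tensor_congr_right R h'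
    _ ≅ᵤ (R ⊠ R') ⊠ G := (tensor_assoc _ _ _).symm

theorem ShiftEquivalent.trans (h : ShiftEquivalent E F) (h' : ShiftEquivalent F G) :
    ShiftEquivalent E G := by
  obtain ⟨R, S, n, h1, h2, h3, h4⟩ := h
  obtain ⟨R', S', k, h1', h2', h3', h4'⟩ := h'
  refine ⟨R ⊠ R', S' ⊠ S, k + n + 1, tensor_tensor_tpowSucc h1 h1' h4, ?_,
    (tensor_comm_trans h3'.symm h3.symm).symm, tensor_comm_trans h4 h4'⟩
  -- For `G` the two shift equivalences enter in the opposite order, so the lags appear exchanged.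
  rw [Nat.add_comm k n]
  exact tensor_tensor_tpowSucc h2' h2 h3'.symm

theorem StrongShiftEquivalent.shiftEquivalent (h : StrongShiftEquivalent E F) :
    ShiftEquivalent E F := by
  suffices ∀ P Q : Over.{u},
      Relation.TransGen (fun P Q : Over.{u} => ElementaryStrongShiftEquivalent P.corr Q.corr) P Q →
        ShiftEquivalent P.corr Q.corr from this ⟨A, E⟩ ⟨B, F⟩ h
  intro P Q h
  induction h with
  | single h => exact h.shiftEquivalent
  | tail _ h ih => exact ih.trans h.shiftEquivalent

end shift

/-! ## The dual of an imprimitivity bimodule -/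

section dual

variable {A B : Type u} [NonUnitalCStarAlgebra A] [NonUnitalCStarAlgebra B]

/-- The vector space conjugate to a correspondence. -/
def Conj (M : CStarCorrespondence A B) : Type u := M

variable {M : CStarCorrespondence A B}

instance : AddCommGroup (Conj M) := inferInstanceAs (AddCommGroup M)

noncomputable instance : Module ℂ (Conj M) := Module.compHom M (starRingEnd ℂ)

/-- By `compat`, the difference `a` of the two sides annihilates `M`. Hence `a` annihilates all
values of `l`, so by fullness all of `A`, and `a a* = 0` forces `a = 0`. -/
theorem IsLeftInner.rmul_left {l : M →ₗ[ℂ] M →ₗ⋆[ℂ] A} (hl : IsLeftInner M l)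
    (hd : TotalFamily fun p : M × M => l p.1 p.2) (x y : M) (b : B) :
    l (M.rmul x b) y = l x (M.rmul y (star b)) := by
  rw [← sub_eq_zero]
  set a := l (M.rmul x b) y - l x (M.rmul y (star b)) with ha
  have h1 : ∀ z, M.φ a z = 0 := fun z => by
    rw [ha, map_sub, LinearMap.sub_apply, hl.compat, hl.compat, inner_rmul_left, star_star,
      M.rmul_mul, sub_self]
  have h2 : ∀ c, a * c = 0 := hd.eq_of_continuous (S := LinearMap.mulLeft ℂ a) (T := 0)
    (continuous_const_mul a) continuous_const fun p => by
      change a * l p.1 p.2 = 0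
      rw [← hl.φ_left, h1, map_zero, LinearMap.zero_apply]
  exact (CStarRing.mul_star_self_eq_zero_iff a).1 (h2 _)

theorem IsLeftInner.φ_right {l : M →ₗ[ℂ] M →ₗ⋆[ℂ] A} (hl : IsLeftInner M l) (x y : M) (a : A) :
    l x (M.φ a y) = l x y * star a := by
  rw [← hl.star_left, hl.φ_left, star_mul, hl.star_left]

/-- The conjugate of an imprimitivity bimodule. -/
noncomputable def preDual (l : M →ₗ[ℂ] M →ₗ⋆[ℂ] A) (hl : IsLeftInner M l)
    (hd : TotalFamily fun p : M × M => l p.1 p.2) : PreCorrespondence B A where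
  carrier := Conj M
  -- Writing `x̃` for `x` in the conjugate space, the structure is `x̃ a = (a* x)~`, `b x̃ = (x
  -- b*)~` and `⟨x̃, ỹ⟩ = l x y`.
  rmul := LinearMap.mk₂ ℂ (fun (x : Conj M) a => (M.φ (star a) x : M))
    (fun x x' a => (M.φ (star a)).map_add x x')
    (fun c x a => (M.φ (star a)).map_smul (starRingEnd ℂ c) x)
    (fun x a a' => by rw [star_add, map_add]; rfl)
    (fun c x a => by rw [star_smul, map_smul]; rfl)
  inner := LinearMap.mk₂'ₛₗ (starRingEnd ℂ) (RingHom.id ℂ) (fun (x y : Conj M) => l x y)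
    (fun (x x' y : M) => l.map_add₂ x x' y)
    (fun c (x y : M) => LinearMap.map_smul₂ l (starRingEnd ℂ c) x y)
    (fun (x y y' : M) => (l x).map_add y y')
    (fun c (x y : M) => ((l x).map_smulₛₗ (starRingEnd ℂ c) y).trans
      (by rw [starRingEnd_self_apply]; rfl))
  φ :=
    { toFun := fun b =>
        { toFun := fun (x : Conj M) => (M.rmul x (star b) : M)
          map_add' := fun x y => M.rmul.map_add₂ x y (star b)
          map_smul' := fun c x => M.rmul.map_smul₂ (starRingEnd ℂ c) x (star b) }
      map_add' := fun b b' => LinearMap.ext fun (x : M) =>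
        (congrArg (M.rmul x) (star_add b b')).trans ((M.rmul x).map_add _ _)
      map_zero' := LinearMap.ext fun (x : M) =>
        (congrArg (M.rmul x) (star_zero B)).trans (M.rmul x).map_zero
      map_smul' := fun c b => LinearMap.ext fun (x : M) =>
        (congrArg (M.rmul x) (star_smul c b)).trans ((M.rmul x).map_smul _ _)
      map_mul' := fun b b' => LinearMap.ext fun (x : M) =>
        (congrArg (M.rmul x) (star_mul b b')).trans (M.rmul_mul x _ _) }
  rmul_mul := fun (x : M) a a' =>
    (congrArg (fun c => M.φ c x) (star_mul a a')).trans (M.φ_mul _ _ x)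
  inner_rmul := fun (x y : M) a => (hl.φ_right x y (star a)).trans (by rw [star_star]; rfl)
  star_inner := hl.star_left
  inner_self_pos := hl.pos
  inner_φ := fun b (x y : M) => hl.rmul_left hd x y (star b)

/-- Imprimitivity bimodules are invertible. -/
theorem IsImprimitivityBimodule.exists_isInverse (h : M.IsImprimitivityBimodule) :
    ∃ N, IsInverse M N := by
  obtain ⟨hr, l, hl, hd⟩ := h
  have hr : TotalFamily fun p : M × M => M.inner p.1 p.2 := by
    have e : {c : B | ∃ x y : M, M.inner x y = c} = Set.range fun p : M × M => M.inner p.1 p.2 :=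
      Set.ext fun c => by simp
    rw [e] at hr
    exact hr
  have hd : TotalFamily fun p : M × M => l p.1 p.2 := by
    have e : {c : A | ∃ x y : M, l x y = c} = Set.range fun p : M × M => l p.1 p.2 :=
      Set.ext fun c => by simp
    rw [e] at hd
    exact hd
  let P := preDual l hl hd
  -- Only the density of the image of `M` in `N` and the formulas on that image are used.
  let N := P.completion
  let i : M → N := fun x => ((show P from x : P) : UniformSpace.Completion P)
  have hi : TotalFamily i := TotalFamily.of_forall fun K hK h x => by
    induction x using UniformSpace.Completion.induction_on with
    | hp => exact hK
    | ih x => exact h x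
  have inner_i : ∀ x y, N.inner (i x) (i y) = l x y := fun x y => P.complInner_coe x y
  have φ_i : ∀ b x, N.φ b (i x) = i (M.rmul x (star b)) := fun b x => P.complφ_coe x b
  have hid : TotalFamily (id : M → M) := .of_surjective Function.surjective_id
  -- The unitaries are `x ⊗ ỹ ↦ l x y` and `x̃ ⊗ y ↦ ⟨x, y⟩`; fullness on each side gives the total
  -- families in `A` and `B`.
  refine ⟨N, unitarilyEquivalent_of_gram (f := fun p : M × M => tmul M N p.1 (i p.2))
    (g := fun p : M × M => l p.1 p.2) ?_ hd ?_ ?_,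
    unitarilyEquivalent_of_gram (f := fun p : M × M => tmul N M (i p.1) p.2)
    (g := fun p : M × M => M.inner p.1 p.2) ?_ hr ?_ ?_⟩
  · exact hid.map₂ hi (tmulₗ M N) (continuous_tmul_left _ _) (continuous_tmul_right _ _)
      (total_tmul M N)
  · rintro ⟨x, y⟩ ⟨x', y'⟩
    change _ = star (l x y) * l x' y'
    rw [inner_tmul, φ_i, inner_i, hl.star_left, ← hl.φ_left, hl.compat, hl.rmul_left hd]
  · rintro a ⟨x, y⟩
    exact ⟨(M.φ a x, y), φ_tmul M N a x (i y), (hl.φ_left a x y).symm⟩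
  · exact hi.map₂ hid (tmulₗ N M) (continuous_tmul_left _ _) (continuous_tmul_right _ _)
      (total_tmul N M)
  · rintro ⟨x, y⟩ ⟨x', y'⟩
    change _ = star (M.inner x y) * M.inner x' y'
    rw [inner_tmul, inner_i, hl.compat, M.inner_rmul, M.star_inner]
  · rintro b ⟨x, y⟩
    refine ⟨(M.rmul x (star b), y), ?_, ?_⟩
    · change (N ⊠ M).φ b (tmul N M (i x) y) = tmul N M (i (M.rmul x (star b))) y
      rw [φ_tmul, φ_i]
    · change b * M.inner x y = M.inner (M.rmul x (star b)) y
      rw [inner_rmul_left, star_star]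

end dual

/-! ## Invertible correspondences are imprimitivity bimodules -/

section pairing

variable {A B : Type u} [NonUnitalCStarAlgebra A] [NonUnitalCStarAlgebra B]

theorem rmul_tmul {C : Type u} [NonUnitalCStarAlgebra C] (X : CStarCorrespondence A B)
    (Y : CStarCorrespondence B C) (x : X) (y : Y) (c : C) :
    (tensor X Y).rmul (tmul X Y x y) c = tmul X Y x (Y.rmul y c) :=
  (preTensor X Y).complRmul_coe (x ⊗ₜ[ℂ] y : X ⊗[ℂ] Y) c

/-- A pairing that induces a unitary bimodule map from `X ⊗ Y` onto `A`. -/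
structure IsPairing (X : CStarCorrespondence A B) (Y : CStarCorrespondence B A)
    (u : X →ₗ[ℂ] Y →ₗ[ℂ] A) : Prop where
  star_mul : ∀ x y x' y', star (u x y) * u x' y' = Y.inner y (Y.φ (X.inner x x') y')
  φ_left : ∀ a x y, u (X.φ a x) y = a * u x y
  rmul_right : ∀ x y a, u x (Y.rmul y a) = u x y * a
  balanced : ∀ x b y, u (X.rmul x b) y = u x (Y.φ b y)
  total : TotalFamily fun p : X × Y => u p.1 p.2

variable {X : CStarCorrespondence A B} {Y : CStarCorrespondence B A}

/-- Take `u x y = U (x ⊗ y)` for a unitary `U` from `X ⊗ Y` onto `A`. -/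
theorem exists_isPairing (h : X ⊠ Y ≅ᵤ idCorr A) : ∃ u : X →ₗ[ℂ] Y →ₗ[ℂ] A, IsPairing X Y u := by
  obtain ⟨U, hU⟩ := h.exists_isUnitary
  refine ⟨LinearMap.compr₂ (tmulₗ X Y) (show (X ⊠ Y) →ₗ[ℂ] A from U.toLinearMap),
    fun x y x' y' => ?_, fun a x y => ?_, fun x y a => ?_, fun x b y => ?_, ?_⟩
  · exact (hU.inner _ _).trans (inner_tmul X Y x x' y y')
  · exact (congrArg U (φ_tmul X Y a x y)).symm.trans (hU.φ _ _)
  · exact (congrArg U (rmul_tmul X Y x y a)).symm.trans (hU.rmul _ _)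
  · exact congrArg U (tensor_balanced X Y x b y)
  · exact (total_tmul X Y).map (T := U.toLinearMap) hU.continuous (.of_surjective U.surjective)

theorem _root_.TotalFamily.star {ι : Type*} {f : ι → A} (hf : TotalFamily f) :
    TotalFamily fun i => star (f i) :=
  hf.map (T := (starLinearEquiv ℂ : A ≃ₗ⋆[ℂ] A).toLinearMap) continuous_star
    (.of_surjective (starLinearEquiv ℂ : A ≃ₗ⋆[ℂ] A).surjective)

namespace IsPairing

variable {u : X →ₗ[ℂ] Y →ₗ[ℂ] A} (hu : IsPairing X Y u)

include hu

theorem norm_le (x : X) (y : Y) : ‖u x y‖ ≤ ‖x‖ * ‖y‖ := by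
  refine (sq_le_sq₀ (norm_nonneg _) (by positivity)).1 ?_
  have h : ‖u x y‖ ^ 2 = ‖tmul X Y x y‖ ^ 2 := by
    rw [(X ⊠ Y).norm_sq, inner_tmul, ← hu.star_mul, CStarRing.norm_star_mul_self, sq]
  rw [h]
  exact pow_le_pow_left₀ (norm_nonneg _) (norm_tmul_le X Y x y) 2

theorem continuous_left (y : Y) : Continuous fun x => u x y :=
  ((u.flip y).mkContinuous ‖y‖ fun x => by rw [mul_comm]; exact hu.norm_le x y).continuous

theorem continuous_right (x : X) : Continuous fun y => u x y :=
  ((u x).mkContinuous ‖x‖ (hu.norm_le x)).continuous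

/-- Testing against `ξ` itself gives `‖ξ‖² = ‖u x ξ‖ ≤ ‖x‖ ‖ξ‖`. -/
theorem norm_le_of_inner_eq {x : X} {ξ : Y} (h : ∀ y, Y.inner ξ y = u x y) : ‖ξ‖ ≤ ‖x‖ := by
  rcases (norm_nonneg ξ).eq_or_lt with h0 | h0
  · rw [← h0]; exact norm_nonneg _
  · refine le_of_mul_le_mul_right ?_ h0
    rw [← sq, Y.norm_sq, h]
    exact hu.norm_le x ξ

/-- The vectors `x` for which `u x` is the inner product with a vector of `Y`. -/
def representable (_ : IsPairing X Y u) : Submodule ℂ X where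
  carrier := {x | ∃ ξ, ∀ y, Y.inner ξ y = u x y}
  zero_mem' := ⟨0, by simp⟩
  add_mem' := by
    rintro x x' ⟨ξ, h⟩ ⟨ξ', h'⟩
    exact ⟨ξ + ξ', fun y => by simp [h, h']⟩
  smul_mem' := by
    rintro c x ⟨ξ, h⟩
    exact ⟨starRingEnd ℂ c • ξ, fun y => by simp [h]⟩

/-- The representing vector depends contractively on `x`, so it converges along a convergent
sequence because `Y` is complete. -/
theorem isClosed_representable : IsClosed (hu.representable : Set X) := by
  refine IsSeqClosed.isClosed fun x x₀ hx hlim => ?_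
  choose ξ hξ using hx
  have hle : ∀ m n, dist (ξ m) (ξ n) ≤ dist (x m) (x n) := fun m n => by
    rw [dist_eq_norm, dist_eq_norm]
    exact hu.norm_le_of_inner_eq fun y => by simp [hξ]
  have hc : CauchySeq ξ := by
    refine Metric.cauchySeq_iff.2 fun ε hε => ?_
    obtain ⟨N, hN⟩ := Metric.cauchySeq_iff.1 hlim.cauchySeq ε hε
    exact ⟨N, fun m hm n hn => (hle m n).trans_lt (hN m hm n hn)⟩
  obtain ⟨ξ₀, hξ₀⟩ := cauchySeq_tendsto_of_complete hc
  refine ⟨ξ₀, fun y => ?_⟩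
  refine tendsto_nhds_unique (((Y.continuous_inner_left y).tendsto ξ₀).comp hξ₀) ?_
  simpa only [Function.comp_def, hξ] using ((hu.continuous_left y).tendsto x₀).comp hlim

/-- A pairing on a left nondegenerate correspondence is implemented by a conjugate linear map. -/
theorem exists_inner_eq (hX : X.LeftNondegenerate) :
    ∃ J : X →ₗ⋆[ℂ] Y, ∀ x y, Y.inner (J x) y = u x y := by
  have h : ∀ x, x ∈ hu.representable := by
    -- By nondegeneracy and totality of the values of `u`, it is enough to represent vectors `u(r,
    -- s)* x`. There `u(u(r, s)* x, y) = u(r, s)* u(x, y) = ⟨s, ⟨r, x⟩ y⟩ = ⟨⟨x, r⟩ s, y⟩`.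
    refine hX.mem_of_isClosed hu.isClosed_representable fun p => ?_
    refine hu.total.star.mem_of_isClosed (K := hu.representable.comap (X.φₗ.flip p.2))
      (hu.isClosed_representable.preimage (X.continuous_φ_left p.2)) (fun q => ?_) p.1
    refine ⟨Y.φ (X.inner p.2 q.1) q.2, fun y => ?_⟩
    change _ = u (X.φ (star (u q.1 q.2)) p.2) y
    rw [hu.φ_left, hu.star_mul, Y.inner_φ, X.star_inner]
  choose J hJ using h
  refine ⟨⟨⟨J, fun x x' => Y.ext_inner_left fun y => ?_⟩, fun c x => Y.ext_inner_left fun y => ?_⟩,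
    hJ⟩
  · simp [hJ]
  · change Y.inner (J (c • x)) y = Y.inner (starRingEnd ℂ c • J x) y
    simp [hJ]

/-- A pairing can be changed by a unitary of `Y`; this freedom is what `exists_compatible` exploits.
-/
theorem comp_right {U : Y ≃ₗ[ℂ] Y} (hU : IsUnitary U) :
    IsPairing X Y (u.compl₂ U.toLinearMap) where
  star_mul x y x' y' := by simp [hu.star_mul, ← hU.φ, hU.inner]
  φ_left a x y := by simp [hu.φ_left]
  rmul_right x y a := by simp [hU.rmul, hu.rmul_right]
  balanced x b y := by simp [hU.φ, hu.balanced]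
  total := hu.total.trans fun K _ hK p => by
    have := hK (p.1, U.symm p.2)
    simpa using this

/-- Pairings of `X`, `Y` and of `Y`, `X` can be made compatible. -/
theorem exists_compatible {v₀ : Y →ₗ[ℂ] X →ₗ[ℂ] B} (hv : IsPairing Y X v₀)
    (hX : X.LeftNondegenerate) :
    ∃ v : Y →ₗ[ℂ] X →ₗ[ℂ] B, IsPairing Y X v ∧
      ∀ x y x', X.rmul x (v y x') = X.φ (u x y) x' := by
  have hid : TotalFamily (id : X → X) := .of_surjective Function.surjective_id
  have hf : TotalFamily fun p : X × Y × X => X.rmul p.1 (v₀ p.2.1 p.2.2) :=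
    hid.map₂ hv.total X.rmul X.continuous_rmul_left X.continuous_rmul_right
      (X.total_rmul)
  have hg : TotalFamily fun p : X × Y × X => X.φ (u p.1 p.2.1) p.2.2 :=
    (hu.total.map₂ hid X.φₗ X.continuous_φ_left X.continuous_φ_right hX).trans
      fun K _ hK p => hK (p.1.1, p.1.2, p.2)
  -- The families `x v₀(y, x')` and `u(x, y) x'` have the same Gram matrix, so a unitary bimodule
  -- map `W` of `X` carries the first to the second. Replacing `v₀(y, x')` by `v₀(y, W x')` absorbs
  -- it.
  obtain ⟨W, hW, hWfg⟩ := exists_isUnitary hf hg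
    (fun p q => by
      rw [X.inner_rmul, inner_rmul_left, mul_assoc, ← hv.φ_left, hv.star_mul, X.inner_φ, ← X.φ_mul,
        hu.star_mul])
    (fun a p => ⟨(X.φ a p.1, p.2), X.φ_rmul _ _ _, by rw [hu.φ_left, X.φ_mul]⟩)
  refine ⟨_, hv.comp_right hW, fun x y x' => W.injective ?_⟩
  rw [hW.φ]
  exact hWfg (x, y, W x')

end IsPairing

/-- An invertible correspondence is an imprimitivity bimodule. -/
theorem IsInverse.isImprimitivityBimodule {R : CStarCorrespondence A B}
    {S : CStarCorrespondence B A} (h : IsInverse R S) : R.IsImprimitivityBimodule := by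
  have hR := h.leftNondegenerate
  have hS := h.symm.leftNondegenerate
  obtain ⟨u, hu⟩ := exists_isPairing h.1
  obtain ⟨v₀, hv₀⟩ := exists_isPairing h.2
  obtain ⟨v, hv, huv⟩ := hu.exists_compatible hv₀ hR
  obtain ⟨J, hJ⟩ := hu.exists_inner_eq hR
  have hφJ : ∀ r r' s, S.φ (R.inner r r') s = S.rmul (J r) (u r' s) := fun r r' s =>
    S.ext_inner fun z => by
      rw [S.inner_rmul, ← hu.star_mul, ← hJ r, S.star_inner]
  have hJφ : ∀ a r, J (R.φ a r) = S.rmul (J r) (star a) := fun a r =>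
    S.ext_inner_left fun z => by rw [inner_rmul_left, hJ, hJ, hu.φ_left, star_star]
  -- On vectors `u(r, s) w`: `v(J y, u(r, s) w) = v(J y · u(r, s), w) = v(⟨y, r⟩ s, w) = ⟨y, r⟩ v(s,
  -- w) = ⟨y, r v(s, w)⟩ = ⟨y, u(r, s) w⟩`, the last equality by compatibility.
  have hvJ : ∀ y w, v (J y) w = R.inner y w := fun y => by
    refine hR.eq_of_continuous (hv.continuous_right _) (R.continuous_inner_right y) fun p => ?_
    refine hu.total.eq_of_continuous (S := v (J y) ∘ₗ R.φₗ.flip p.2)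
      (T := R.inner y ∘ₗ R.φₗ.flip p.2)
      ((hv.continuous_right _).comp (R.continuous_φ_left p.2))
      ((R.continuous_inner_right y).comp (R.continuous_φ_left p.2)) (fun q => ?_) p.1
    change v (J y) (R.φ (u q.1 q.2) p.2) = R.inner y (R.φ (u q.1 q.2) p.2)
    rw [← hv.balanced, ← hφJ, hv.φ_left, ← huv, R.inner_rmul]
  -- The vector `J x` represents `u x`, and `x` represents `v (J x)`; each gives one inequality.
  have hnorm : ∀ x, ‖J x‖ = ‖x‖ := fun x =>
    le_antisymm (hu.norm_le_of_inner_eq (hJ x))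
      (hv.norm_le_of_inner_eq fun w => (hvJ x w).symm)
  -- Products `v(s, x)* v(s', x')` are total in `B`, and each equals `⟨x, ⟨s, s'⟩ x'⟩`.
  have hright : TotalFamily fun p : R × R => R.inner p.1 p.2 :=
    (hv.total.star.map₂ hv.total (LinearMap.mul ℂ B) continuous_mul_const continuous_const_mul
      (total_mul B)).trans fun K _ hK p => by
        change star (v p.1.1 p.1.2) * v p.2.1 p.2.2 ∈ K
        rw [hv.star_mul]
        exact hK (p.1.2, R.φ (S.inner p.1.1 p.2.1) p.2.2)
  -- The vectors `⟨r, r'⟩ s = J r · u(r', s) = J(u(r', s)* r)` lie in the range of `J` and are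
  -- total, by right fullness of `R` and nondegeneracy of `S`.
  have hJtot : TotalFamily J :=
    (hright.map₂ (g := (id : S → S)) (.of_surjective Function.surjective_id) S.φₗ
      S.continuous_φ_left S.continuous_φ_right hS).trans fun K _ hK p => by
        change S.φ (R.inner p.1.1 p.1.2) p.2 ∈ K
        have := hK (R.φ (star (u p.1.2 p.2)) p.1.1)
        rwa [hJφ, star_star, ← hφJ] at this
  let l : R →ₗ[ℂ] R →ₗ⋆[ℂ] A := LinearMap.mk₂'ₛₗ (RingHom.id ℂ) (starRingEnd ℂ)
    (fun x y => S.inner (J x) (J y)) (by simp) (by simp) (by simp) (by simp)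
  have hl : ∀ x y, l x y = S.inner (J x) (J y) := fun x y => rfl
  have hlnorm : ∀ x, √‖l x x‖ = ‖x‖ := fun x => by rw [hl, ← S.norm_eq_sqrt, hnorm]
  have hleft : TotalFamily fun p : R × R => l p.1 p.2 :=
    hu.total.trans fun K hK h p => by
      rw [← hJ]
      exact hJtot.mem_of_isClosed (K := K.comap (S.inner (J p.1)))
        (hK.preimage (S.continuous_inner_right _)) (fun y => h (p.1, y)) p.2
  have e₁ : {b : B | ∃ x y : R, R.inner x y = b} = Set.range fun p : R × R => R.inner p.1 p.2 :=
    Set.ext fun c => by simp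
  have e₂ : {a : A | ∃ x y : R, l x y = a} = Set.range fun p : R × R => l p.1 p.2 :=
    Set.ext fun c => by simp
  refine ⟨by rw [e₁]; exact hright, l, ⟨fun a x y => ?_, fun x y => S.star_inner _ _,
    fun x => S.inner_self_pos _, fun x hx => ?_, fun x hx => ?_, fun x y z => ?_⟩,
    by rw [e₂]; exact hleft⟩
  · rw [hl, hJφ, inner_rmul_left, star_star, hl]
  · rw [← norm_eq_zero, ← hlnorm, hx, norm_zero, Real.sqrt_zero]
  -- Since `J` is isometric, the norm of `l` is the norm of `R`, which is complete.
  · simp only [hlnorm, ← dist_eq_norm] at hx ⊢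
    obtain ⟨y, hy⟩ := cauchySeq_tendsto_of_complete (Metric.cauchySeq_iff.2 hx)
    exact ⟨y, Metric.tendsto_atTop.1 hy⟩
  -- `l(x, y) z = u(x, J y) z = x v(J y, z) = x ⟨y, z⟩`.
  · rw [hl, hJ, ← huv, hvJ]

end pairing

/-! ## Morita equivalence and shift equivalence of imprimitivity bimodules -/

section morita

variable {A B : Type u} [NonUnitalCStarAlgebra A] [NonUnitalCStarAlgebra B]
  {E : CStarCorrespondence A A} {F : CStarCorrespondence B B}

/-- Take `R = E ⊗ M` and `S` the inverse of `M`. -/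
theorem StrongMoritaEquivalent.elementaryStrongShiftEquivalent (h : StrongMoritaEquivalent E F)
    (hF : F.LeftNondegenerate) : ElementaryStrongShiftEquivalent E F := by
  obtain ⟨M, hM, hEF⟩ := h
  obtain ⟨N, hMN, hNM⟩ := hM.exists_isInverse
  refine ⟨E ⊠ M, N, .symm ?_, .symm ?_⟩
  · calc (E ⊠ M) ⊠ N ≅ᵤ E ⊠ (M ⊠ N) := tensor_assoc _ _ _
      _ ≅ᵤ E ⊠ idCorr A := tensor_congr_right E hMN
      _ ≅ᵤ E := tensor_idCorr E
  · calc N ⊠ (E ⊠ M) ≅ᵤ N ⊠ (M ⊠ F) := tensor_congr_right N hEF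
      _ ≅ᵤ (N ⊠ M) ⊠ F := (tensor_assoc _ _ _).symm
      _ ≅ᵤ idCorr B ⊠ F := tensor_congr_left hNM F
      _ ≅ᵤ F := idCorr_tensor hF

theorem ShiftEquivalent.strongMoritaEquivalent (h : ShiftEquivalent E F)
    {E' : CStarCorrespondence A A} (hE : IsInverse E E') {F' : CStarCorrespondence B B}
    (hF : IsInverse F F') : StrongMoritaEquivalent E F := by
  obtain ⟨R, S, n, hRS, hSR, hS, hR⟩ := h
  obtain ⟨P, hP⟩ := hE.tpowSucc n
  obtain ⟨Q, hQ⟩ := hF.tpowSucc n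
  -- Shift equivalence does not require `S` to be nondegenerate; it follows from `S ≈ F ⊗ S ⊗ E'`,
  -- as `F` is nondegenerate.
  have hSnd : S.LeftNondegenerate := by
    refine ((hF.leftNondegenerate.tensor S).tensor E').congr ?_
    calc (F ⊠ S) ⊠ E' ≅ᵤ (S ⊠ E) ⊠ E' := tensor_congr_left hS.symm E'
      _ ≅ᵤ S ⊠ (E ⊠ E') := tensor_assoc _ _ _
      _ ≅ᵤ S ⊠ idCorr A := tensor_congr_right S hE.1
      _ ≅ᵤ S := tensor_idCorr S
  have h1 : R ⊠ (S ⊠ P) ≅ᵤ idCorr A :=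
    calc R ⊠ (S ⊠ P) ≅ᵤ (R ⊠ S) ⊠ P := (tensor_assoc _ _ _).symm
      _ ≅ᵤ tpowSucc E n ⊠ P := tensor_congr_left hRS.symm P
      _ ≅ᵤ idCorr A := hP.1
  have h2 : (Q ⊠ S) ⊠ R ≅ᵤ idCorr B :=
    calc (Q ⊠ S) ⊠ R ≅ᵤ Q ⊠ (S ⊠ R) := tensor_assoc _ _ _
      _ ≅ᵤ Q ⊠ tpowSucc F n := tensor_congr_right Q hSR.symm
      _ ≅ᵤ idCorr B := hQ.2
  exact ⟨R, (isInverse_of_left_of_right h1 h2 (hSnd.tensor P)).isImprimitivityBimodule, hR⟩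

end morita

end CStarCorrespondence

/-! ### The equivalence of the four relations. -/

theorem theoremT {A B : Type u} [NonUnitalCStarAlgebra A] [NonUnitalCStarAlgebra B]
    (E : CStarCorrespondence A A) (F : CStarCorrespondence B B)
    (hE : E.IsImprimitivityBimodule) (hF : F.IsImprimitivityBimodule) :
    List.TFAE
      [CStarCorrespondence.StrongMoritaEquivalent E F,
       CStarCorrespondence.ElementaryStrongShiftEquivalent E F,
       CStarCorrespondence.StrongShiftEquivalent E F,
       CStarCorrespondence.ShiftEquivalent E F] := by
  obtain ⟨E', hE'⟩ := hE.exists_isInverse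
  obtain ⟨F', hF'⟩ := hF.exists_isInverse
  tfae_have 1 → 2 := fun h => h.elementaryStrongShiftEquivalent hF'.leftNondegenerate
  tfae_have 2 → 3 := fun h => Relation.TransGen.single h
  tfae_have 3 → 4 := fun h => h.shiftEquivalent
  tfae_have 4 → 1 := fun h => h.strongMoritaEquivalent hE' hF'
  tfae_finish
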